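/- Let $a,b,m>0$, $q>2$ and $\delta>0$, and write $B_r=\{x\in\mathbb R^2:|x|<r\}$ (so $B_r=\emptyset$ if $r\le 0$). There is a constant $C^*=C^*(a,b,m,q,\delta)>0$ such that every positive solution $u$ of $$-\Delta u+ae^{bu}-m|\nabla u|^q=0\quad\text{in } B_1\setminus\{0\}$$ satisfies $$|\nabla u(x)|\le \frac{C^*}{|x|}\qquad\text{for all }x\in B_{1-\delta}\setminus\{0\}.$$ Here a solution is a function $u\in C^1(B_1\setminus\{0\})$ which satisfies the equation in the sense of distributions, that is, $$\int_{B_1\setminus\{0\}}\Big(-u\,\Delta\zeta+\big(ae^{bu}-m|\nabla u|^q\big)\zeta\Big)\,dx=0\qquad\text{for all }\zeta\in C_c^\infty(B_1\setminus\{0\}).$$ -/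

import Mathlib

open MeasureTheory
open scoped ContDiff Gradient Laplacian

/-- The Euclidean plane `ℝ²`. -/
abbrev Plane : Type := EuclideanSpace ℝ (Fin 2)

/-- The punctured open unit disk `B₁ \ {0}` of `ℝ²`. -/
def puncturedDisk : Set Plane := Metric.ball (0 : Plane) 1 \ {0}

/-- `u` is a solution of `-Δu + a e^{bu} - m |∇u|^q = 0` in the open set `Ω ⊆ ℝ²`:
`u` is of class `C¹` in `Ω` and the equation holds in the sense of distributions in `Ω`,
i.e. when it is tested against every smooth function whose support is a compact subset of `Ω`.
All terms of the integrand are continuous with compact support in `Ω` when `q ≥ 0`.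
The values of `u` outside `Ω` play no role. -/
structure IsSolutionOn (a b m q : ℝ) (Ω : Set Plane) (u : Plane → ℝ) : Prop where
  contDiffOn : ContDiffOn ℝ 1 u Ω
  weak_eq : ∀ ζ : Plane → ℝ, ContDiff ℝ ∞ ζ → HasCompactSupport ζ → tsupport ζ ⊆ Ω →
    ∫ x in Ω, (-(u x * Δ ζ x) + (a * Real.exp (b * u x) - m * ‖∇ u x‖ ^ q) * ζ x) = 0

/-! ### Averages of a C¹ function against isotropic weights -/

section MeanValue

open Metric Set Filter Topology
open scoped RealInnerProductSpace

variable {E : Type*} [NormedAddCommGroup E] [InnerProductSpace ℝ E]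

/-! The estimate is local: it suffices to have |∇u(x)| ≤ C/R whenever B_R(x) lies in the domain and
R ≤ 1, with C depending only on a, b, m, q. This is Bernstein's method. For smooth u with Δu = f = a
e^{bu} - m|∇u|^q and W = |∇u|², Bochner's formula gives ½ΔW = |D²u|² + ab e^{bu} W -
(mq/2)|∇u|^{q-2}⟨∇u, ∇W⟩, with |D²u|² ≥ f²/2. If a e^{bu} ≥ (m/2)|∇u|^q, the second term is of order
|∇u|^{q+2}. Otherwise |f| ≥ (m/2)|∇u|^q and the first is of order |∇u|^{2q}, which is at least
|∇u|^{q+2} for large gradients since q > 2. Where the barrier Aρ²/(ρ² - |x - x₀|²)² touches W from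
above, its first and second derivatives bound the remaining terms by a small multiple of |∇u|^{q+2}
once A is large: a contradiction, which bounds W(x₀).

Since u is only C¹, W is replaced by the mean square difference of u at scale r, divided by r², and
ΔW by means of its increments at a second scale s → 0. The weak equation enters only through radial
test functions (`HasMeanFlux`). `IsIsotropicPair.integral_mul_add_le` is the discrete Bochner
formula, `IsIsotropicPair.bernstein` inserts the equation, `exists_forall_not_bernstein` excludes
contact with a large barrier, and `exists_norm_gradient_le` is the local estimate. Bounds and moduli
of continuity of u and ∇u decide only how small r must be, so they do not enter C. -/

theorem abs_sub_sub_inner_le {u : E → ℝ} {G : E → E}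
    (hu : ∀ x, HasFDerivAt u (innerSL ℝ (G x)) x) (hG : UniformContinuous G) {ε : ℝ}
    (hε : 0 < ε) : ∃ η > 0, ∀ x h : E, ‖h‖ < η → |u (x + h) - u x - ⟪G x, h⟫| ≤ ε * ‖h‖ := by
  obtain ⟨η, hη, H⟩ := Metric.uniformContinuous_iff.1 hG ε hε
  refine ⟨η, hη, fun x h hh => ?_⟩
  have := (convex_ball x η).norm_image_sub_le_of_norm_hasFDerivWithin_le' (f := u)
    (f' := fun z => innerSL ℝ (G z)) (φ := innerSL ℝ (G x)) (C := ε) (x := x) (y := x + h)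
    (fun z _ => (hu z).hasFDerivWithinAt) (fun z hz => ?_) (mem_ball_self hη) (by simpa using hh)
  · simpa using this
  · rw [← map_sub, innerSL_apply_norm, ← dist_eq_norm]
    exact (H hz).le

variable [FiniteDimensional ℝ E] [MeasurableSpace E] [BorelSpace E]

/-- A continuous function is integrable for a finite measure carried by the closed unit ball. -/
theorem Continuous.integrable_of_ae_norm_le {μ : Measure E} [IsFiniteMeasure μ]
    (hμ : ∀ᵐ y ∂μ, ‖y‖ ≤ 1) {F : E → ℝ} (hF : Continuous F) : Integrable F μ := by
  obtain ⟨C, hC⟩ := (isCompact_closedBall (0 : E) 1).exists_bound_of_continuousOn hF.continuousOn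
  refine Integrable.of_bound hF.aestronglyMeasurable C ?_
  filter_upwards [hμ] with y hy
  exact hC y (by simpa using hy)

/-- The weights used to test the equation: `μ` and `ν` are carried by the closed unit ball,
and `μ` is isotropic up to second order. -/
structure IsIsotropicPair (μ ν : Measure E) (c : ℝ) : Prop where
  norm_le_left : ∀ᵐ y ∂μ, ‖y‖ ≤ 1
  norm_le_right : ∀ᵐ y ∂ν, ‖y‖ ≤ 1
  first_moment : ∀ v : E, ∫ y, ⟪v, y⟫ ∂μ = 0
  second_moment : ∀ v : E, ∫ y, ⟪v, y⟫ ^ 2 ∂μ = c * ‖v‖ ^ 2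

/-- The integrated form of `Δ u = f` in `U`, where `G` is the gradient of `u`. -/
def HasMeanFlux (μ ν : Measure E) (U : Set E) (G : E → E) (f : E → ℝ) : Prop :=
  ∀ x s, 0 < s → closedBall x s ⊆ U →
    ∫ y, ⟪y, G (x + s • y)⟫ ∂μ = s * ∫ y, f (x + s • y) ∂ν

variable {μ ν : Measure E} [IsFiniteMeasure μ] {c : ℝ}

theorem IsIsotropicPair.hasDerivAt_mean (h : IsIsotropicPair μ ν c) {u : E → ℝ} {G : E → E}
    (hu : ∀ x, HasFDerivAt u (innerSL ℝ (G x)) x) (hG : Continuous G) (x : E) (s : ℝ) :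
    HasDerivAt (fun t : ℝ => ∫ y, u (x + t • y) ∂μ) (∫ y, ⟪y, G (x + s • y)⟫ ∂μ) s := by
  have huc : Continuous u := continuous_iff_continuousAt.2 fun x => (hu x).continuousAt
  obtain ⟨C, hC⟩ := (isCompact_closedBall x (|s| + 1)).exists_bound_of_continuousOn
    hG.continuousOn
  refine (hasDerivAt_integral_of_dominated_loc_of_deriv_le (s := ball s 1)
    (F' := fun t y => ⟪y, G (x + t • y)⟫) (bound := fun _ => C)
    (ball_mem_nhds s one_pos) ?_ ?_ ?_ ?_ (integrable_const C) ?_).2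
  · exact Eventually.of_forall fun t =>
      (huc.comp (by fun_prop : Continuous fun y : E => x + t • y)).aestronglyMeasurable
  · exact Continuous.integrable_of_ae_norm_le h.norm_le_left (by fun_prop)
  · exact (by fun_prop : Continuous fun y : E => ⟪y, G (x + s • y)⟫).aestronglyMeasurable
  · filter_upwards [h.norm_le_left] with y hy t ht
    have hts : |t| ≤ |s| + 1 := by
      rw [mem_ball, Real.dist_eq] at ht
      have := abs_sub_abs_le_abs_sub t s
      linarith
    have h1 : ‖G (x + t • y)‖ ≤ C := hC _ (by
      simp only [mem_closedBall, dist_self_add_left, norm_smul, Real.norm_eq_abs]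
      nlinarith [abs_nonneg t, norm_nonneg y])
    calc ‖⟪y, G (x + t • y)⟫‖ ≤ ‖y‖ * ‖G (x + t • y)‖ := norm_inner_le_norm _ _
      _ ≤ 1 * C := by gcongr
      _ = C := one_mul C
  · refine Eventually.of_forall fun y t _ => ?_
    have h1 : HasDerivAt (fun t : ℝ => x + t • y) y t := by
      simpa using ((hasDerivAt_id t).smul_const y).const_add x
    simpa [real_inner_comm, Function.comp_def] using (hu (x + t • y)).comp_hasDerivAt t h1

/-- To first order the second difference is s⟪G z - G x, y⟫, uniformly in x and z, and the second
moment evaluates its mean square. This becomes the squared-Hessian term of Bochner's formula. -/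
theorem IsIsotropicPair.le_mean_sq (h : IsIsotropicPair μ ν c) {u : E → ℝ} {G : E → E}
    (hu : ∀ x, HasFDerivAt u (innerSL ℝ (G x)) x) (hG : UniformContinuous G) {L : ℝ}
    (hL : ∀ x, ‖G x‖ ≤ L) {ε : ℝ} (hε : 0 < ε) :
    ∃ η > 0, ∀ s, 0 < s → s < η → ∀ x z,
      s ^ 2 * (c * ‖G z - G x‖ ^ 2 - ε) ≤
        ∫ y, ((u (z + s • y) - u (x + s • y)) - (u z - u x)) ^ 2 ∂μ := by
  have huc : Continuous u := continuous_iff_continuousAt.2 fun x => (hu x).continuousAt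
  have hL0 : 0 ≤ L := (norm_nonneg _).trans (hL 0)
  have hN : 0 ≤ μ.real univ := measureReal_nonneg
  -- Below, |B| ≤ 2Ls and |A - B| ≤ 2ε's, so A² ≥ B² + 2B(A - B) loses at most 8Lε's².
  set ε' := ε / (8 * L * μ.real univ + 1) with hε'
  have hε'0 : 0 < ε' := by positivity
  obtain ⟨η, hη, H⟩ := abs_sub_sub_inner_le hu hG hε'0
  refine ⟨η, hη, fun s hs hsη x z => ?_⟩
  have hpt : ∀ᵐ y ∂μ, s ^ 2 * (⟪G z - G x, y⟫ ^ 2 - 8 * L * ε') ≤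
      ((u (z + s • y) - u (x + s • y)) - (u z - u x)) ^ 2 := by
    filter_upwards [h.norm_le_left] with y hy
    have hsy : ‖s • y‖ ≤ s := by
      rw [norm_smul, Real.norm_of_nonneg hs.le]; nlinarith
    have h1 := H z (s • y) (hsy.trans_lt hsη)
    have h2 := H x (s • y) (hsy.trans_lt hsη)
    have h3 : |⟪G z - G x, s • y⟫| ≤ 2 * L * s := by
      refine (abs_real_inner_le_norm _ _).trans ?_
      have := norm_sub_le (G z) (G x)
      have : ‖G z - G x‖ ≤ 2 * L := by linarith [hL z, hL x]
      gcongr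
    set A := (u (z + s • y) - u (x + s • y)) - (u z - u x)
    set B := ⟪G z - G x, s • y⟫ with hB
    have hAB : |A - B| ≤ 2 * ε' * s := by
      have : A - B = (u (z + s • y) - u z - ⟪G z, s • y⟫)
          - (u (x + s • y) - u x - ⟪G x, s • y⟫) := by
        simp only [A, B, inner_sub_left]; ring
      rw [this]
      refine (abs_sub _ _).trans ?_
      nlinarith
    have hBB : s ^ 2 * ⟪G z - G x, y⟫ ^ 2 = B ^ 2 := by rw [hB, inner_smul_right]; ring
    rw [mul_sub, hBB]
    have : |B * (A - B)| ≤ 2 * L * s * (2 * ε' * s) := by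
      rw [abs_mul]; gcongr
    have := (abs_le.1 this).1
    nlinarith [sq_nonneg (A - B)]
  have hint := integral_mono_ae (μ := μ) (Continuous.integrable_of_ae_norm_le h.norm_le_left
    (by fun_prop)) (Continuous.integrable_of_ae_norm_le h.norm_le_left (by fun_prop)) hpt
  refine le_trans ?_ hint
  rw [integral_const_mul, integral_sub (Continuous.integrable_of_ae_norm_le h.norm_le_left
    (by fun_prop)) (integrable_const _), h.second_moment, integral_const, smul_eq_mul]
  have : μ.real univ * (8 * L * ε') ≤ ε := by
    rw [hε', ← mul_assoc, mul_div_assoc', div_le_iff₀ (by positivity)]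
    nlinarith
  gcongr

variable [IsFiniteMeasure ν]

/-- A Laplacian for C¹ functions: the mean over scale t has derivative equal to the flux t ∫ f(x +
ty) dν, which is close to t ν(E) f(x); integrate from 0 to s. -/
theorem IsIsotropicPair.mean_sub_expansion (h : IsIsotropicPair μ ν c) {u f : E → ℝ} {G : E → E}
    (hu : ∀ x, HasFDerivAt u (innerSL ℝ (G x)) x) (hG : Continuous G) (hf : UniformContinuous f)
    {U : Set E} (hflux : HasMeanFlux μ ν U G f) {ε : ℝ} (hε : 0 < ε) :
    ∃ η > 0, ∀ s, 0 < s → s < η → ∀ x, closedBall x s ⊆ U →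
      |∫ y, (u (x + s • y) - u x) ∂μ - s ^ 2 / 2 * (ν.real univ * f x)| ≤ ε * s ^ 2 := by
  have huc : Continuous u := continuous_iff_continuousAt.2 fun x => (hu x).continuousAt
  set ε' := ε / (ν.real univ + 1) with hε'
  have hN : 0 ≤ ν.real univ := measureReal_nonneg
  have hε'0 : 0 < ε' := by positivity
  obtain ⟨η, hη, H⟩ := Metric.uniformContinuous_iff.1 hf ε' hε'0
  refine ⟨η, hη, fun s hs hsη x hx => ?_⟩
  set M : ℝ → ℝ := fun t => ∫ y, u (x + t • y) ∂μ - t ^ 2 / 2 * (ν.real univ * f x) with hM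
  have hder : ∀ t, HasDerivAt M
      (∫ y, ⟪y, G (x + t • y)⟫ ∂μ - t * (ν.real univ * f x)) t := fun t => by
    refine (h.hasDerivAt_mean hu hG x t).sub ?_
    have := (((hasDerivAt_id t).pow 2).div_const 2).mul_const (ν.real univ * f x)
    convert! this using 1
    simp
  have hbd : ∀ t ∈ Ico (0 : ℝ) s,
      ‖∫ y, ⟪y, G (x + t • y)⟫ ∂μ - t * (ν.real univ * f x)‖ ≤ ε * s := by
    intro t ht
    -- The flux identity needs t > 0; at t = 0 the derivative is a first moment, hence zero.
    rcases ht.1.eq_or_lt with rfl | ht0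
    · have := h.first_moment (G x)
      simp only [real_inner_comm] at this ⊢
      simp [this]; positivity
    rw [hflux x t ht0 ((closedBall_subset_closedBall ht.2.le).trans hx)]
    have hint : Integrable (fun y => f (x + t • y)) ν :=
      Continuous.integrable_of_ae_norm_le h.norm_le_right
        (hf.continuous.comp (by fun_prop))
    have h1 : ‖∫ y, (f (x + t • y) - f x) ∂ν‖ ≤ ε' * ν.real univ := by
      refine norm_integral_le_of_norm_le_const ?_
      filter_upwards [h.norm_le_right] with y hy
      rw [← dist_eq_norm]
      refine (H ?_).le
      simp only [dist_self_add_left, norm_smul, Real.norm_eq_abs, abs_of_pos ht0]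
      nlinarith [ht.2, norm_nonneg y]
    rw [integral_sub hint (integrable_const _), integral_const, smul_eq_mul] at h1
    rw [← mul_sub, norm_mul, Real.norm_of_nonneg ht0.le]
    have h2 : ε' * ν.real univ ≤ ε := by
      rw [hε', div_mul_eq_mul_div, div_le_iff₀ (by positivity)]
      nlinarith
    calc _ ≤ s * ε := by
          gcongr
          · exact ht.2.le
          · exact h1.trans h2
      _ = ε * s := mul_comm _ _
  have key := norm_image_sub_le_of_norm_deriv_le_segment' (f := M)
    (fun t _ => (hder t).hasDerivWithinAt) hbd s (right_mem_Icc.2 hs.le)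
  have hint : Integrable (fun y => u (x + s • y)) μ :=
    Continuous.integrable_of_ae_norm_le h.norm_le_left (by fun_prop)
  rw [integral_sub hint (integrable_const _)]
  rw [Real.norm_eq_abs] at key
  convert! key using 1
  · simp [hM]; ring_nf
  · ring

end MeanValue

/-! ### The discrete Bochner formula at a touching point -/

section SecondOrder

open Metric Set Filter Topology
open scoped RealInnerProductSpace

variable {E : Type*} [NormedAddCommGroup E] [InnerProductSpace ℝ E] [MeasurableSpace E]
  [BorelSpace E] {μ ν : Measure E} [IsFiniteMeasure μ] {c : ℝ}

/-- The mean square difference of `u` at scale `r`. -/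
noncomputable def meanSqDiff (μ : Measure E) (u : E → ℝ) (r : ℝ) (x : E) : ℝ :=
  ∫ y, (u (x + r • y) - u x) ^ 2 ∂μ

theorem continuous_meanSqDiff {u : E → ℝ} (hu : Continuous u) {B : ℝ} (hB : ∀ x, |u x| ≤ B)
    (r : ℝ) : Continuous (meanSqDiff μ u r) := by
  refine continuous_of_dominated (bound := fun _ => 4 * B ^ 2)
    (fun z => (by fun_prop : Continuous fun y : E => (u (z + r • y) - u z) ^ 2).aestronglyMeasurable)
    (fun z => Eventually.of_forall fun y => ?_) (integrable_const _)
    (Eventually.of_forall fun y => by fun_prop)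
  have : |u (z + r • y) - u z| ≤ 2 * B := by
    refine (abs_sub _ _).trans ?_
    linarith [hB (z + r • y), hB z]
  rw [Real.norm_of_nonneg (sq_nonneg _)]
  nlinarith [sq_le_sq' (abs_le.1 this).1 (abs_le.1 this).2]

variable [FiniteDimensional ℝ E]

/-- The first-order condition at contact: on each line through x, the mean square difference minus
the paraboloid has a local maximum at x. -/
theorem IsIsotropicPair.two_mul_integral_eq_inner (h : IsIsotropicPair μ ν c)
    {u : E → ℝ} {G : E → E}
    (hu : ∀ x, HasFDerivAt u (innerSL ℝ (G x)) x) (hG : Continuous G) {r K : ℝ} {x p : E}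
    (hmax : ∀ᶠ v in 𝓝 (0 : E),
      meanSqDiff μ u r (x + v) ≤ meanSqDiff μ u r x + ⟪p, v⟫ + K * ‖v‖ ^ 2) (v : E) :
    2 * ∫ y, (u (x + r • y) - u x) * ⟪G (x + r • y) - G x, v⟫ ∂μ = ⟪p, v⟫ := by
  have huc : Continuous u := continuous_iff_continuousAt.2 fun x => (hu x).continuousAt
  have hder : HasDerivAt (fun t : ℝ => meanSqDiff μ u r (x + t • v))
      (∫ y, 2 * ((u (x + r • y) - u x) * ⟪G (x + r • y) - G x, v⟫) ∂μ) 0 := by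
    have hcont : Continuous fun z : ℝ × E => 2 * ((u (x + z.1 • v + r • z.2) - u (x + z.1 • v)) *
        ⟪G (x + z.1 • v + r • z.2) - G (x + z.1 • v), v⟫) := by fun_prop
    obtain ⟨C, hC⟩ := ((isCompact_closedBall (0 : ℝ) 1).prod
      (isCompact_closedBall (0 : E) 1)).exists_bound_of_continuousOn hcont.continuousOn
    have := (hasDerivAt_integral_of_dominated_loc_of_deriv_le (μ := μ) (x₀ := (0 : ℝ))
      (s := ball 0 1)
      (F := fun t y => (u (x + t • v + r • y) - u (x + t • v)) ^ 2)
      (F' := fun t y => 2 * ((u (x + t • v + r • y) - u (x + t • v)) *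
        ⟪G (x + t • v + r • y) - G (x + t • v), v⟫)) (bound := fun _ => C)
      (ball_mem_nhds _ one_pos) ?_ ?_ ?_ ?_ (integrable_const C) ?_).2
    · simpa [meanSqDiff] using this
    · exact Eventually.of_forall fun t => (by fun_prop : Continuous fun y : E =>
        (u (x + t • v + r • y) - u (x + t • v)) ^ 2).aestronglyMeasurable
    · exact Continuous.integrable_of_ae_norm_le h.norm_le_left (by fun_prop)
    · exact (hcont.comp (by fun_prop : Continuous fun y : E => ((0 : ℝ), y))).aestronglyMeasurable
    · filter_upwards [h.norm_le_left] with y hy t ht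
      exact hC (t, y) ⟨ball_subset_closedBall ht, by simpa using hy⟩
    · refine Eventually.of_forall fun y t _ => ?_
      have h1 : HasDerivAt (fun t : ℝ => x + t • v) v t := by
        simpa using ((hasDerivAt_id t).smul_const v).const_add x
      have h2 := (hu (x + t • v)).comp_hasDerivAt t h1
      have h3 := (hu (x + t • v + r • y)).comp_hasDerivAt t (h1.add_const (r • y))
      convert! (h3.sub h2).pow 2 using 1
      simp [inner_sub_left]; ring
  have hder2 : HasDerivAt (fun t : ℝ => meanSqDiff μ u r (x + t • v) - t * ⟪p, v⟫
      - K * ‖v‖ ^ 2 * t ^ 2)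
      (∫ y, 2 * ((u (x + r • y) - u x) * ⟪G (x + r • y) - G x, v⟫) ∂μ - ⟪p, v⟫) 0 := by
    convert! (hder.sub ((hasDerivAt_id (0 : ℝ)).mul_const ⟪p, v⟫)).sub
      (((hasDerivAt_id (0 : ℝ)).pow 2).const_mul (K * ‖v‖ ^ 2)) using 1
    simp
  have hloc : IsLocalMax (fun t : ℝ => meanSqDiff μ u r (x + t • v) - t * ⟪p, v⟫
      - K * ‖v‖ ^ 2 * t ^ 2) 0 := by
    have ht : Tendsto (fun t : ℝ => t • v) (𝓝 0) (𝓝 0) :=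
      (by fun_prop : Continuous fun t : ℝ => t • v).tendsto' 0 0 (zero_smul ℝ v)
    filter_upwards [ht.eventually hmax] with t ht
    simp only [inner_smul_right, norm_smul, mul_pow, Real.norm_eq_abs, sq_abs] at ht
    simp
    linarith
  have := hloc.hasDerivAt_eq_zero hder2
  rw [integral_const_mul] at this
  linarith

variable [IsFiniteMeasure ν]

/-- At a point where a paraboloid touches the mean square difference of `u` from above, the
Laplacian of the latter, computed from `Δ u = f`, is at most that of the paraboloid. -/
theorem IsIsotropicPair.integral_mul_add_le (h : IsIsotropicPair μ ν c) {u f : E → ℝ} {G : E → E}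
    (hu : ∀ x, HasFDerivAt u (innerSL ℝ (G x)) x) (hG : UniformContinuous G)
    (hf : UniformContinuous f) {B L : ℝ} (hB : ∀ x, |u x| ≤ B) (hL : ∀ x, ‖G x‖ ≤ L)
    {U : Set E} (hflux : HasMeanFlux μ ν U G f) {r η K : ℝ} (hη : 0 < η) {x p : E}
    (hxU : closedBall x (|r| + η) ⊆ U)
    (hmax : ∀ᶠ v in 𝓝 (0 : E),
      meanSqDiff μ u r (x + v) ≤ meanSqDiff μ u r x + ⟪p, v⟫ + K * ‖v‖ ^ 2) :
    ν.real univ * ∫ y, (u (x + r • y) - u x) * (f (x + r • y) - f x) ∂μ +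
      c * ∫ y, ‖G (x + r • y) - G x‖ ^ 2 ∂μ ≤ K * ∫ y, ‖y‖ ^ 2 ∂μ := by
  have huc : Continuous u := continuous_iff_continuousAt.2 fun x => (hu x).continuousAt
  have hGc := hG.continuous
  have hfc := hf.continuous
  have hB0 : 0 ≤ B := (abs_nonneg _).trans (hB 0)
  have hint : ∀ {F : E → ℝ}, Continuous F → Integrable F μ := fun hF =>
    Continuous.integrable_of_ae_norm_le h.norm_le_left hF
  set m := μ.real univ with hm
  have hm0 : 0 ≤ m := measureReal_nonneg
  refine le_of_forall_pos_le_add fun ε hε => ?_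
  set ε' := ε / ((8 * B + 1) * m + 1) with hε'
  have hε'0 : 0 < ε' := by positivity
  obtain ⟨η₁, hη₁, H₁⟩ := h.mean_sub_expansion hu hGc hf hflux hε'0
  obtain ⟨η₂, hη₂, H₂⟩ := h.le_mean_sq hu hG hL hε'0
  obtain ⟨η₃, hη₃, H₃⟩ := Metric.eventually_nhds_iff.1 hmax
  obtain ⟨s, hs0, hs⟩ : ∃ s, 0 < s ∧ s < min (min η η₁) (min η₂ η₃) :=
    exists_between (by positivity)
  simp only [lt_min_iff] at hs
  obtain ⟨⟨hsη, hs₁⟩, hs₂, hs₃⟩ := hs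
  set w : E → E → ℝ := fun y z => u (x + z + r • y) - u (x + z) with hw
  -- the mean over the increments of the square of one fixed difference
  have hlow : ∀ᵐ y ∂μ, s ^ 2 * (ν.real univ * ((u (x + r • y) - u x) * (f (x + r • y) - f x)) +
      c * ‖G (x + r • y) - G x‖ ^ 2 - (8 * B + 1) * ε') ≤
      ∫ z, (w y (s • z) ^ 2 - w y 0 ^ 2) ∂μ := by
    filter_upwards [h.norm_le_left] with y hy
    have hry : ‖r • y‖ ≤ |r| := by
      rw [norm_smul, Real.norm_eq_abs]; nlinarith [abs_nonneg r]
    have h1 := H₁ s hs0 hs₁ (x + r • y) ((closedBall_subset_closedBall' (by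
      simp only [dist_self_add_left]; linarith)).trans hxU)
    have h2 := H₁ s hs0 hs₁ x ((closedBall_subset_closedBall (by
      linarith [abs_nonneg r])).trans hxU)
    have h3 := H₂ s hs0 hs₂ x (x + r • y)
    -- From α² - β² = 2β(α - β) + (α - β)². The mean of the linear part produces the difference of
    -- f, that of the square the Hessian term.
    have hexp : ∫ z, (w y (s • z) ^ 2 - w y 0 ^ 2) ∂μ =
        2 * (u (x + r • y) - u x) * (∫ z, (u (x + r • y + s • z) - u (x + r • y)) ∂μ -
          ∫ z, (u (x + s • z) - u x) ∂μ) +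
        ∫ z, ((u (x + r • y + s • z) - u (x + s • z)) - (u (x + r • y) - u x)) ^ 2 ∂μ := by
      rw [← integral_sub (hint (by fun_prop)) (hint (by fun_prop)), ← integral_const_mul,
        ← integral_add (hint (by fun_prop)) (hint (by fun_prop))]
      refine integral_congr_ae (Eventually.of_forall fun z => ?_)
      have e : x + s • z + r • y = x + r • y + s • z := by abel
      simp only [hw, add_zero, e]
      ring
    rw [hexp]
    have hwB : |u (x + r • y) - u x| ≤ 2 * B := by
      refine (abs_sub _ _).trans ?_
      linarith [hB (x + r • y), hB x]
    set I₁ := ∫ z, (u (x + r • y + s • z) - u (x + r • y)) ∂μ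
    set I₂ := ∫ z, (u (x + s • z) - u x) ∂μ
    have hd : |(u (x + r • y) - u x) * ((I₁ - I₂) - s ^ 2 / 2 * (ν.real univ *
        (f (x + r • y) - f x)))| ≤ 2 * B * (2 * ε' * s ^ 2) := by
      rw [abs_mul]
      refine mul_le_mul hwB ?_ (abs_nonneg _) (by positivity)
      have : (I₁ - I₂) - s ^ 2 / 2 * (ν.real univ * (f (x + r • y) - f x)) =
        (I₁ - s ^ 2 / 2 * (ν.real univ * f (x + r • y))) -
          (I₂ - s ^ 2 / 2 * (ν.real univ * f x)) := by ring
      rw [this]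
      refine (abs_sub _ _).trans ?_
      linarith
    have := (abs_le.1 hd).1
    nlinarith
  have hswap : ∫ z, (meanSqDiff μ u r (x + s • z) - meanSqDiff μ u r x) ∂μ =
      ∫ y, ∫ z, (w y (s • z) ^ 2 - w y 0 ^ 2) ∂μ ∂μ := by
    rw [integral_integral_swap]
    · refine integral_congr_ae (Eventually.of_forall fun z => ?_)
      simp only [meanSqDiff, hw, add_zero]
      rw [← integral_sub (hint (by fun_prop)) (hint (by fun_prop))]
    · refine Integrable.of_bound (Continuous.aestronglyMeasurable ?_) (8 * B ^ 2) ?_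
      · simp only [hw, Function.uncurry_def]; fun_prop
      · refine Eventually.of_forall fun q => ?_
        have hq : ∀ z, |w q.1 z| ≤ 2 * B := fun z => by
          refine (abs_sub _ _).trans ?_
          linarith [hB (x + z + r • q.1), hB (x + z)]
        simp only [Function.uncurry_def, Real.norm_eq_abs]
        refine (abs_sub _ _).trans ?_
        rw [abs_of_nonneg (sq_nonneg _), abs_of_nonneg (sq_nonneg _)]
        have h1 := sq_le_sq' (abs_le.1 (hq (s • q.2))).1 (abs_le.1 (hq (s • q.2))).2
        have h2 := sq_le_sq' (abs_le.1 (hq 0)).1 (abs_le.1 (hq 0)).2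
        nlinarith
  have hQc := continuous_meanSqDiff (μ := μ) huc hB r
  have hup : ∫ z, (meanSqDiff μ u r (x + s • z) - meanSqDiff μ u r x) ∂μ ≤
      s ^ 2 * (K * ∫ y, ‖y‖ ^ 2 ∂μ) := by
    -- The linear part of the paraboloid averages to zero.
    have : ∫ z, (s * ⟪p, z⟫ + s ^ 2 * K * ‖z‖ ^ 2) ∂μ = s ^ 2 * (K * ∫ y, ‖y‖ ^ 2 ∂μ) := by
      rw [integral_add (hint (by fun_prop)) (hint (by fun_prop)), integral_const_mul,
        integral_const_mul, h.first_moment]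
      ring
    rw [← this]
    refine integral_mono_ae (hint (by fun_prop)) (hint (by fun_prop)) ?_
    filter_upwards [h.norm_le_left] with z hz
    have hsz : dist (s • z) 0 < η₃ := by
      rw [dist_zero_right, norm_smul, Real.norm_of_nonneg hs0.le]; nlinarith
    have := H₃ hsz
    simp only [inner_smul_right, norm_smul, mul_pow, Real.norm_eq_abs, sq_abs] at this
    linarith
  have hcI : Continuous fun y => ∫ z, (w y (s • z) ^ 2 - w y 0 ^ 2) ∂μ := by
    refine continuous_of_dominated (bound := fun _ => 8 * B ^ 2)
      (fun y => (by simp only [hw]; fun_prop :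
        Continuous fun z : E => w y (s • z) ^ 2 - w y 0 ^ 2).aestronglyMeasurable)
      (fun y => Eventually.of_forall fun z => ?_) (integrable_const _)
      (Eventually.of_forall fun z => by simp only [hw]; fun_prop)
    have hq : ∀ z, |w y z| ≤ 2 * B := fun z => by
      refine (abs_sub _ _).trans ?_
      linarith [hB (x + z + r • y), hB (x + z)]
    rw [Real.norm_eq_abs]
    refine (abs_sub _ _).trans ?_
    rw [abs_of_nonneg (sq_nonneg _), abs_of_nonneg (sq_nonneg _)]
    have h1 := sq_le_sq' (abs_le.1 (hq (s • z))).1 (abs_le.1 (hq (s • z))).2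
    have h2 := sq_le_sq' (abs_le.1 (hq 0)).1 (abs_le.1 (hq 0)).2
    nlinarith
  have hlow' := integral_mono_ae (hint (by fun_prop)) (hint hcI) hlow
  rw [← hswap, integral_const_mul, integral_sub (hint (by fun_prop)) (integrable_const _),
    integral_add (hint (by fun_prop)) (hint (by fun_prop)), integral_const_mul,
    integral_const_mul, integral_const, smul_eq_mul] at hlow'
  have hfin := le_of_mul_le_mul_left (hlow'.trans hup) (by positivity)
  have : m * ((8 * B + 1) * ε') ≤ ε := by
    rw [hε', ← mul_assoc, mul_div_assoc', div_le_iff₀ (by positivity)]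
    nlinarith
  linarith

end SecondOrder

/-! ### The Bernstein inequality for the equation -/

section Bernstein

open Metric Set Filter Topology
open scoped RealInnerProductSpace

theorem half_mul_sq_le_mul_exp_sub_one {b w : ℝ} (hb : 0 < b) (hw : b * |w| ≤ 1) :
    b / 2 * w ^ 2 ≤ w * (Real.exp (b * w) - 1) := by
  rcases le_total 0 w with h | h
  · have := Real.add_one_le_exp (b * w)
    nlinarith [mul_nonneg hb.le (sq_nonneg w)]
  · rw [abs_of_nonpos h] at hw
    have h1 := Real.add_one_le_exp (-(b * w))
    have h2 : Real.exp (b * w) * Real.exp (-(b * w)) = 1 := by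
      rw [← Real.exp_add]; simp
    have h3 : Real.exp (b * w) ≤ 1 + b * w / 2 := by
      have h4 : Real.exp (b * w) * (-(b * w) + 1) ≤ 1 := by
        rw [← h2]; exact mul_le_mul_of_nonneg_left (by linarith) (Real.exp_pos _).le
      have h5 : 0 ≤ -(b * w) := by nlinarith
      by_contra! h6
      nlinarith
    nlinarith

/-- Used with w, D and γ the increments of u, of |∇u|^q and (in norm) of ∇u, and z = e^{bw} - 1.
Young's inequality splits the Taylor error κγ|w| between w² and γ². -/
theorem le_mul_sub_of_abs_sub_le {b e m κ w D T q I γ z : ℝ} (hm : 0 ≤ m) (he : 0 ≤ e)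
    (hκ : 0 ≤ κ) (h1 : b / 2 * w ^ 2 ≤ w * z) (h2 : |D - q * T * I| ≤ κ * γ) :
    e * (b / 2) * w ^ 2 - m * q * T * (w * I) - m * κ / 2 * (w ^ 2 + γ ^ 2) ≤
      w * (e * z - m * D) := by
  have h3 : w * (D - q * T * I) ≤ κ / 2 * (w ^ 2 + γ ^ 2) := by
    have h4 : |w * (D - q * T * I)| ≤ |w| * (κ * γ) := by
      rw [abs_mul]; gcongr
    have h5 := (abs_le.1 h4).2
    have h8 : 0 ≤ κ / 2 * (|w| - γ) ^ 2 := by positivity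
    rw [sub_sq, sq_abs] at h8
    linarith
  have h6 := mul_le_mul_of_nonneg_left h3 hm
  have h7 := mul_le_mul_of_nonneg_left h1 he
  linarith

/-- With R = r² and κ small, half of the Hessian term absorbs the error in S, and the final +1
absorbs the error in Q. -/
theorem absorb_le {b c c₂ e m q N κ R T J A Q S M K P Y : ℝ} (hm : 0 < m) (hq : 2 < q)
    (hN : 0 ≤ N) (hκ : 0 ≤ κ) (hR : 0 ≤ R) (hS : 0 ≤ S)
    (hI : N * (e * (b / 2) * Q - m * q * T * (R * J / 2) - m * κ / 2 * (Q + S)) ≤ N * A)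
    (hsec : N * A + c * S ≤ R * K * c₂) (hJ : T * J ≤ Y * P) (hQ : Q ≤ R * M)
    (hκ₁ : N * m * κ ≤ c) (hκ₂ : N * m * κ * M ≤ 1) :
    N * (b / 2) * e * Q + c / 2 * S ≤ R * (K * c₂ + N * m * q / 2 * (Y * P) + 1) := by
  have h3 := mul_le_mul_of_nonneg_left hJ (by positivity : 0 ≤ N * m * q / 2 * R)
  have h4 := mul_le_mul_of_nonneg_left hQ (by positivity : 0 ≤ N * m * κ / 2)
  have h5 := mul_le_mul_of_nonneg_right hκ₁ hS
  have h6 := mul_le_mul_of_nonneg_left hκ₂ hR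
  linarith

section Power

variable {E : Type*} [NormedAddCommGroup E] [InnerProductSpace ℝ E] [FiniteDimensional ℝ E]

theorem abs_norm_rpow_sub_sub_le {q : ℝ} (hq : 1 < q) (L : ℝ) {κ : ℝ} (hκ : 0 < κ) :
    ∃ η > 0, ∀ P P' : E, ‖P‖ ≤ L → ‖P'‖ ≤ L → ‖P' - P‖ < η →
      |‖P'‖ ^ q - ‖P‖ ^ q - q * ‖P‖ ^ (q - 2) * ⟪P, P' - P⟫| ≤ κ * ‖P' - P‖ := by
  have hc : Continuous fun x : E => (q * ‖x‖ ^ (q - 2)) • innerSL ℝ x := by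
    have h := (contDiff_norm_rpow (E := E) hq).continuous_fderiv one_ne_zero
    rwa [show fderiv ℝ (fun x : E => ‖x‖ ^ q) = fun x : E => (q * ‖x‖ ^ (q - 2)) • innerSL ℝ x
      from funext fun x => fderiv_norm_rpow x hq] at h
  obtain ⟨η, hη, H⟩ := Metric.uniformContinuousOn_iff.1
    ((isCompact_closedBall (0 : E) L).uniformContinuousOn_of_continuous hc.continuousOn) κ hκ
  refine ⟨η, hη, fun P P' hP hP' hPP => ?_⟩
  have := ((convex_closedBall (0 : E) L).inter (convex_ball P η)
    ).norm_image_sub_le_of_norm_hasFDerivWithin_le'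
    (f := fun x : E => ‖x‖ ^ q) (f' := fun x : E => (q * ‖x‖ ^ (q - 2)) • innerSL ℝ x)
    (φ := (q * ‖P‖ ^ (q - 2)) • innerSL ℝ P) (C := κ) (x := P) (y := P')
    (fun z _ => (hasFDerivAt_norm_rpow z hq).hasFDerivWithinAt) (fun z hz => ?_)
    ⟨by simpa using hP, mem_ball_self hη⟩ ⟨by simpa using hP', by simpa [dist_eq_norm] using hPP⟩
  · simpa using this
  · rw [← dist_eq_norm]
    exact (H z hz.1 P (by simpa using hP) hz.2).le

end Power

variable {E : Type*} [NormedAddCommGroup E] [InnerProductSpace ℝ E] [FiniteDimensional ℝ E]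
  [MeasurableSpace E] [BorelSpace E] {μ ν : Measure E} [IsFiniteMeasure μ] {c : ℝ}

theorem IsIsotropicPair.abs_meanSqDiff_sub_le (h : IsIsotropicPair μ ν c) {u : E → ℝ} {G : E → E}
    (hu : ∀ x, HasFDerivAt u (innerSL ℝ (G x)) x) (hG : UniformContinuous G) {L : ℝ}
    (hL : ∀ x, ‖G x‖ ≤ L) :
    ∃ η > 0, ∀ r, 0 < r → r < η → ∀ x,
      |meanSqDiff μ u r x - r ^ 2 * (c * ‖G x‖ ^ 2)| ≤ r ^ 2 := by
  have huc : Continuous u := continuous_iff_continuousAt.2 fun x => (hu x).continuousAt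
  have hL0 : 0 ≤ L := (norm_nonneg _).trans (hL 0)
  have hm : 0 ≤ μ.real univ := measureReal_nonneg
  set ε := 1 / ((2 * L + 1) * (μ.real univ + 1)) with hε
  have hε0 : 0 < ε := by positivity
  have hε1 : ε ≤ 1 := by
    rw [hε, div_le_one (by positivity)]; nlinarith
  obtain ⟨η, hη, H⟩ := abs_sub_sub_inner_le hu hG hε0
  refine ⟨η, hη, fun r hr hrη x => ?_⟩
  have hint : ∀ {F : E → ℝ}, Continuous F → Integrable F μ := fun hF =>
    Continuous.integrable_of_ae_norm_le h.norm_le_left hF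
  have e : meanSqDiff μ u r x - r ^ 2 * (c * ‖G x‖ ^ 2) =
      ∫ y, ((u (x + r • y) - u x) ^ 2 - r ^ 2 * ⟪G x, y⟫ ^ 2) ∂μ := by
    rw [integral_sub (hint (by fun_prop)) (hint (by fun_prop)), integral_const_mul,
      h.second_moment, meanSqDiff]
  rw [e, ← Real.norm_eq_abs]
  have hb : ‖∫ y, ((u (x + r • y) - u x) ^ 2 - r ^ 2 * ⟪G x, y⟫ ^ 2) ∂μ‖ ≤
      (r ^ 2 * (ε * (2 * L + 1))) * μ.real univ := by
    refine norm_integral_le_of_norm_le_const ?_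
    filter_upwards [h.norm_le_left] with y hy
    have hry : ‖r • y‖ ≤ r := by rw [norm_smul, Real.norm_of_nonneg hr.le]; nlinarith
    have h1 := H x (r • y) (hry.trans_lt hrη)
    set A := u (x + r • y) - u x
    set D := ⟪G x, r • y⟫ with hD
    have h2 : |A - D| ≤ ε * r := h1.trans (by gcongr)
    have h3 : |D| ≤ L * r := (abs_real_inner_le_norm _ _).trans (by gcongr; exact hL x)
    have h4 : r ^ 2 * ⟪G x, y⟫ ^ 2 = D ^ 2 := by rw [hD, inner_smul_right]; ring
    have h5 : |A + D| ≤ (2 * L + 1) * r := by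
      have : A + D = (A - D) + 2 * D := by ring
      rw [this]
      refine (abs_add_le _ _).trans ?_
      rw [abs_mul, abs_two]
      nlinarith
    rw [h4, Real.norm_eq_abs, sq_sub_sq, abs_mul]
    calc |A + D| * |A - D| ≤ ((2 * L + 1) * r) * (ε * r) := by gcongr
      _ = _ := by ring
  refine hb.trans ?_
  have : ε * (2 * L + 1) * μ.real univ ≤ 1 := by
    rw [hε, div_mul_eq_mul_div, div_mul_eq_mul_div, div_le_one (by positivity)]
    nlinarith
  nlinarith [sq_nonneg r]

/-- Cauchy–Schwarz, from the discriminant of t ↦ ∫ ‖ty + γ(y)‖² dμ. It plays the role of (Δu)² ≤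
n|D²u|². -/
theorem sq_integral_inner_le (hμ : ∀ᵐ y ∂μ, ‖y‖ ≤ 1) {γ : E → E} (hγ : Continuous γ) :
    (∫ y, ⟪y, γ y⟫ ∂μ) ^ 2 ≤ (∫ y, ‖y‖ ^ 2 ∂μ) * ∫ y, ‖γ y‖ ^ 2 ∂μ := by
  have hint : ∀ {F : E → ℝ}, Continuous F → Integrable F μ := fun hF =>
    Continuous.integrable_of_ae_norm_le hμ hF
  have := discrim_le_zero (a := ∫ y, ‖y‖ ^ 2 ∂μ) (b := 2 * ∫ y, ⟪y, γ y⟫ ∂μ)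
    (c := ∫ y, ‖γ y‖ ^ 2 ∂μ) (fun t => by
      have e : (∫ y, ‖y‖ ^ 2 ∂μ) * (t * t) + 2 * (∫ y, ⟪y, γ y⟫ ∂μ) * t + ∫ y, ‖γ y‖ ^ 2 ∂μ =
          ∫ y, (‖y‖ ^ 2 * (t * t) + 2 * t * ⟪y, γ y⟫ + ‖γ y‖ ^ 2) ∂μ := by
        rw [integral_add (hint (by fun_prop)) (hint (by fun_prop)),
          integral_add (hint (by fun_prop)) (hint (by fun_prop)), integral_mul_const,
          integral_const_mul]
        ring
      rw [e]
      refine integral_nonneg fun y => ?_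
      have : 0 ≤ ‖t • y + γ y‖ ^ 2 := sq_nonneg _
      rw [norm_add_sq_real, real_inner_smul_left, norm_smul, mul_pow, Real.norm_eq_abs,
        sq_abs] at this
      simp only [Pi.zero_apply]
      linarith)
  unfold discrim at this
  nlinarith

variable [IsFiniteMeasure ν]

/-- The Bernstein inequality at a point where the mean square difference is touched from above
by a paraboloid. -/
theorem IsIsotropicPair.bernstein (h : IsIsotropicPair μ ν c) (hc : 0 < c)
    {a b m q : ℝ} (ha : 0 < a) (hb : 0 < b) (hm : 0 < m) (hq : 2 < q) {u f : E → ℝ} {G : E → E}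
    (hu : ∀ x, HasFDerivAt u (innerSL ℝ (G x)) x) (hG : UniformContinuous G)
    (hf : UniformContinuous f) (hfu : ∀ x, f x = a * Real.exp (b * u x) - m * ‖G x‖ ^ q)
    {B L : ℝ} (hB : ∀ x, |u x| ≤ B) (hL : ∀ x, ‖G x‖ ≤ L)
    {U : Set E} (hflux : HasMeanFlux μ ν U G f) :
    ∃ r₀ > 0, ∀ r, 0 < r → r < r₀ → ∀ η > 0, ∀ x p : E, ∀ K : ℝ, closedBall x (r + η) ⊆ U →
      (∀ᶠ v in 𝓝 (0 : E), meanSqDiff μ u r (x + v) ≤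
        meanSqDiff μ u r x + r ^ 2 * (⟪p, v⟫ + K * ‖v‖ ^ 2)) →
      ∃ Γ F : ℝ, 0 ≤ Γ ∧ |F - ν.real univ * f x| ≤ 1 ∧ F ^ 2 ≤ (∫ y, ‖y‖ ^ 2 ∂μ) * Γ ∧
        ν.real univ * (b / 2) * (a * Real.exp (b * u x)) * (meanSqDiff μ u r x / r ^ 2) +
          c / 2 * Γ ≤ K * (∫ y, ‖y‖ ^ 2 ∂μ) +
            ν.real univ * m * q / 2 * (‖G x‖ ^ (q - 1) * ‖p‖) + 1 := by
  have huc : Continuous u := continuous_iff_continuousAt.2 fun x => (hu x).continuousAt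
  have hGc := hG.continuous
  have hfc := hf.continuous
  have hL0 : 0 ≤ L := (norm_nonneg _).trans (hL 0)
  have hint : ∀ {F : E → ℝ}, Continuous F → Integrable F μ := fun hF =>
    Continuous.integrable_of_ae_norm_le h.norm_le_left hF
  set N := ν.real univ with hN
  have hN0 : 0 ≤ N := measureReal_nonneg
  -- The two entries give the two smallness conditions on κ in `absorb_le`, with M = cL² + 1.
  set κ := min (c / (N * m + 1)) (1 / ((N * m + 1) * (c * L ^ 2 + 1))) with hκ
  have hκ0 : 0 < κ := by positivity
  have hκ1 : N * m * κ ≤ c := by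
    have : κ ≤ c / (N * m + 1) := min_le_left _ _
    rw [le_div_iff₀ (by positivity)] at this
    nlinarith
  have hκ2 : N * m * κ * (c * L ^ 2 + 1) ≤ 1 := by
    have : κ ≤ 1 / ((N * m + 1) * (c * L ^ 2 + 1)) := min_le_right _ _
    rw [le_div_iff₀ (by positivity)] at this
    have h1 : 0 ≤ κ * (c * L ^ 2 + 1) := by positivity
    nlinarith
  obtain ⟨η₁, hη₁, H₁⟩ := h.abs_meanSqDiff_sub_le hu hG hL
  obtain ⟨η₂, hη₂, H₂⟩ := abs_norm_rpow_sub_sub_le (E := E) (by linarith : 1 < q) L hκ0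
  obtain ⟨η₃, hη₃, H₃⟩ := Metric.uniformContinuous_iff.1 hG η₂ hη₂
  obtain ⟨η₄, hη₄, H₄⟩ := Metric.uniformContinuous_iff.1 hf (1 / (N + 1)) (by positivity)
  refine ⟨min (min η₁ η₃) (min η₄ (1 / (b * (L + 1)))), by positivity,
    fun r hr hrr η hη x p K hxU hmax => ?_⟩
  simp only [lt_min_iff] at hrr
  obtain ⟨⟨hr1, hr3⟩, hr4, hr5⟩ := hrr
  have hmax' : ∀ᶠ v in 𝓝 (0 : E), meanSqDiff μ u r (x + v) ≤
      meanSqDiff μ u r x + ⟪r ^ 2 • p, v⟫ + r ^ 2 * K * ‖v‖ ^ 2 := by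
    filter_upwards [hmax] with v hv
    rw [real_inner_smul_left]
    linarith
  -- Taken in the direction G x, the first-order condition evaluates the integral produced by
  -- linearizing |∇u|^q.
  have hlin := h.two_mul_integral_eq_inner hu hGc hmax' (G x)
  have hsec := h.integral_mul_add_le hu hG hf hB hL hflux hη
    (by rwa [abs_of_pos hr]) hmax'
  have hW := H₁ r hr hr1 x
  set Q := meanSqDiff μ u r x with hQ
  set c₂ := ∫ y, ‖y‖ ^ 2 ∂μ
  set S := ∫ y, ‖G (x + r • y) - G x‖ ^ 2 ∂μ with hS
  set g := ‖G x‖ with hg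
  set e := a * Real.exp (b * u x) with he
  have he0 : 0 < e := by positivity
  have hry : ∀ y : E, ‖y‖ ≤ 1 → dist (x + r • y) x ≤ r := fun y hy => by
    simp only [dist_self_add_left, norm_smul, Real.norm_of_nonneg hr.le]; nlinarith
  have hpt : ∀ᵐ y ∂μ, e * (b / 2) * (u (x + r • y) - u x) ^ 2 -
      m * q * g ^ (q - 2) * ((u (x + r • y) - u x) * ⟪G (x + r • y) - G x, G x⟫) -
      m * κ / 2 * ((u (x + r • y) - u x) ^ 2 + ‖G (x + r • y) - G x‖ ^ 2) ≤
      (u (x + r • y) - u x) * (f (x + r • y) - f x) := by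
    filter_upwards [h.norm_le_left] with y hy
    have hd := hry y hy
    have hlip : |u (x + r • y) - u x| ≤ L * r := by
      have := (convex_univ (𝕜 := ℝ) (E := E)).norm_image_sub_le_of_norm_hasFDerivWithin_le
        (f := u) (f' := fun z => innerSL ℝ (G z)) (C := L) (x := x) (y := x + r • y)
        (fun z _ => (hu z).hasFDerivWithinAt)
        (fun z _ => by rw [innerSL_apply_norm]; exact hL z) (mem_univ _) (mem_univ _)
      rw [Real.norm_eq_abs, ← dist_eq_norm (x + r • y)] at this
      exact this.trans (by gcongr)
    have h2 := H₂ (G x) (G (x + r • y)) (hL _) (hL _) (by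
      rw [← dist_eq_norm]; exact H₃ (hd.trans_lt hr3))
    rw [real_inner_comm] at h2
    set w := u (x + r • y) - u x with hw
    set γ := G (x + r • y) - G x
    have h1 := half_mul_sq_le_mul_exp_sub_one (w := w) hb (by
      rw [lt_div_iff₀ (by positivity)] at hr5
      calc b * |w| ≤ b * (L * r) := by gcongr
        _ ≤ 1 := by nlinarith [mul_pos hb hr])
    have hexp : f (x + r • y) - f x =
        e * (Real.exp (b * w) - 1) - m * (‖G (x + r • y)‖ ^ q - g ^ q) := by
      rw [hfu, hfu, he]
      have : b * u (x + r • y) = b * u x + b * w := by rw [hw]; ring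
      rw [this, Real.exp_add]
      ring
    rw [hexp]
    exact le_mul_sub_of_abs_sub_le hm.le he0.le hκ0.le h1 h2
  have hI := integral_mono_ae (hint (by fun_prop)) (hint (by fun_prop)) hpt
  rw [integral_sub (hint (by fun_prop)) (hint (by fun_prop)),
    integral_sub (hint (by fun_prop)) (hint (by fun_prop)), integral_const_mul,
    integral_const_mul, integral_const_mul, integral_add (hint (by fun_prop)) (hint (by fun_prop)),
    show ∫ y, (u (x + r • y) - u x) ^ 2 ∂μ = Q from rfl, ← hS] at hI
  have hr2 : 0 < r ^ 2 := by positivity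
  have hS0 : 0 ≤ S := integral_nonneg fun _ => sq_nonneg _
  have hflux' := hflux x r hr ((closedBall_subset_closedBall (by linarith)).trans hxU)
  refine ⟨S / r ^ 2, ∫ y, f (x + r • y) ∂ν, by positivity, ?_, ?_, ?_⟩
  · have hi : Integrable (fun y => f (x + r • y)) ν :=
      Continuous.integrable_of_ae_norm_le h.norm_le_right (by fun_prop)
    have h1 : ‖∫ y, (f (x + r • y) - f x) ∂ν‖ ≤ 1 / (N + 1) * N := by
      refine norm_integral_le_of_norm_le_const ?_
      filter_upwards [h.norm_le_right] with y hy
      rw [← dist_eq_norm]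
      exact (H₄ ((hry y hy).trans_lt hr4)).le
    rw [integral_sub hi (integrable_const _), integral_const, smul_eq_mul] at h1
    refine h1.trans ?_
    rw [div_mul_eq_mul_div, div_le_one (by positivity)]
    linarith
  · have h1 := sq_integral_inner_le h.norm_le_left
      (by fun_prop : Continuous fun y => G (x + r • y) - G x)
    -- Subtracting the constant G x costs nothing, the first moment being zero, so the flux identity
    -- still applies.
    have h2 : ∫ y, ⟪y, G (x + r • y) - G x⟫ ∂μ = r * ∫ y, f (x + r • y) ∂ν := by
      simp_rw [inner_sub_right]
      have := h.first_moment (G x)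
      simp_rw [real_inner_comm] at this
      rw [integral_sub (hint (by fun_prop)) (hint (by fun_prop)), hflux', this, sub_zero]
    rw [h2, mul_pow] at h1
    rw [mul_div_assoc', le_div_iff₀ hr2]
    linarith
  · have hgq : g ^ (q - 2) * ⟪p, G x⟫ ≤ g ^ (q - 1) * ‖p‖ := by
      have h1 : g ^ (q - 1) = g ^ (q - 2) * g := by
        rw [← Real.rpow_add_one' (norm_nonneg _) (by linarith)]
        congr 1; ring
      rw [h1, mul_assoc, mul_comm g]
      gcongr
      exact real_inner_le_norm _ _
    have hQle : Q ≤ r ^ 2 * (c * L ^ 2 + 1) := by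
      have h1 := (abs_le.1 hW).2
      have h2 : g ^ 2 ≤ L ^ 2 := by gcongr; exact hL x
      nlinarith [mul_le_mul_of_nonneg_left h2 (mul_pos hr2 hc).le]
    rw [real_inner_smul_left] at hlin
    have hI' := mul_le_mul_of_nonneg_left hI hN0
    set J := ∫ y, (u (x + r • y) - u x) * ⟪G (x + r • y) - G x, G x⟫ ∂μ
    have hJ : J = r ^ 2 * ⟪p, G x⟫ / 2 := by linarith
    rw [hJ] at hI'
    have key := absorb_le hm hq hN0 hκ0.le hr2.le hS0 hI' hsec hgq hQle hκ1 hκ2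
    have hdiv : N * (b / 2) * e * (Q / r ^ 2) + c / 2 * (S / r ^ 2) =
        (N * (b / 2) * e * Q + c / 2 * S) / r ^ 2 := by ring
    rw [hdiv, div_le_iff₀ hr2]
    linarith

end Bernstein

/-! ### Contact with a large barrier is impossible -/

section Barrier

open Metric Set Filter Topology
open scoped RealInnerProductSpace

theorem one_div_sq_le {t t' : ℝ} (ht : 0 < t) (h : t / 2 ≤ t') :
    1 / t' ^ 2 ≤ 1 / t ^ 2 - 2 * (t' - t) / t ^ 3 + 20 * (t' - t) ^ 2 / t ^ 4 := by
  have ht' : 0 < t' := by linarith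
  have e : 1 / t ^ 2 - 2 * (t' - t) / t ^ 3 + 20 * (t' - t) ^ 2 / t ^ 4 - 1 / t' ^ 2 =
      (t' - t) ^ 2 * (17 * t ^ 2 + 38 * t * (t' - t) + 20 * (t' - t) ^ 2) / (t ^ 4 * t' ^ 2) := by
    field_simp
    ring
  have h2 : 0 ≤ 17 * t ^ 2 + 38 * t * (t' - t) + 20 * (t' - t) ^ 2 := by nlinarith
  have : 0 ≤ (t' - t) ^ 2 * (17 * t ^ 2 + 38 * t * (t' - t) + 20 * (t' - t) ^ 2) /
      (t ^ 4 * t' ^ 2) := by positivity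
  linarith

/-- The barrier `A ρ² / (ρ² - |x - x₀|²)²` lies below an explicit paraboloid at each point. -/
theorem eventually_le_paraboloid {E : Type*} [NormedAddCommGroup E] [InnerProductSpace ℝ E]
    {W : E → ℝ} {x₀ x : E} {ρ A : ℝ} (hρ : 0 < ρ) (hA : 0 ≤ A) (hx : x ∈ ball x₀ ρ)
    (hle : ∀ z ∈ closedBall x₀ ρ, (ρ ^ 2 - ‖z - x₀‖ ^ 2) ^ 2 * W z ≤ A * ρ ^ 2)
    (heq : (ρ ^ 2 - ‖x - x₀‖ ^ 2) ^ 2 * W x = A * ρ ^ 2) :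
    ∀ᶠ v in 𝓝 (0 : E), W (x + v) ≤ W x +
      (⟪(4 * A * ρ ^ 2 / (ρ ^ 2 - ‖x - x₀‖ ^ 2) ^ 3) • (x - x₀), v⟫ +
        182 * A * ρ ^ 4 / (ρ ^ 2 - ‖x - x₀‖ ^ 2) ^ 4 * ‖v‖ ^ 2) := by
  have hxn : ‖x - x₀‖ < ρ := by rwa [mem_ball, dist_eq_norm] at hx
  set d := ‖x - x₀‖ with hd
  have hd0 : 0 ≤ d := norm_nonneg _
  set t := ρ ^ 2 - d ^ 2 with ht
  have ht0 : 0 < t := by rw [ht]; nlinarith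
  have htρ : t ≤ ρ ^ 2 := by rw [ht]; nlinarith
  have hcont : Tendsto (fun v : E => ρ ^ 2 - ‖x + v - x₀‖ ^ 2) (𝓝 0) (𝓝 t) :=
    (by fun_prop : Continuous fun v : E => ρ ^ 2 - ‖x + v - x₀‖ ^ 2).tendsto' 0 t (by simp [ht, hd])
  filter_upwards [hcont.eventually (lt_mem_nhds (half_lt_self ht0)), ball_mem_nhds (0 : E) hρ]
    with v hv1 hv2
  rw [mem_ball_zero_iff] at hv2
  set t' := ρ ^ 2 - ‖x + v - x₀‖ ^ 2 with ht'
  have ht'0 : 0 < t' := by linarith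
  have hvB : x + v ∈ closedBall x₀ ρ := by
    rw [mem_closedBall, dist_eq_norm]
    nlinarith [norm_nonneg (x + v - x₀)]
  have h1 : W (x + v) ≤ A * ρ ^ 2 * (1 / t' ^ 2) := by
    rw [mul_one_div, le_div_iff₀ (by positivity), mul_comm]
    exact hle _ hvB
  have h2 : W x = A * ρ ^ 2 * (1 / t ^ 2) := by
    rw [mul_one_div, eq_div_iff (by positivity), mul_comm]
    exact heq
  have hdiff : t' - t = -(2 * ⟪x - x₀, v⟫ + ‖v‖ ^ 2) := by
    have : x + v - x₀ = (x - x₀) + v := by abel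
    rw [ht', ht, this, norm_add_sq_real, hd]
    ring
  have h3 := one_div_sq_le ht0 hv1.le
  set i := ⟪x - x₀, v⟫ with hi
  have hi' : |i| ≤ ρ * ‖v‖ := (abs_real_inner_le_norm _ _).trans (by gcongr)
  have h4 : (t' - t) ^ 2 ≤ 9 * ρ ^ 2 * ‖v‖ ^ 2 := by
    have : |t' - t| ≤ 3 * ρ * ‖v‖ := by
      rw [hdiff, abs_neg]
      refine (abs_add_le _ _).trans ?_
      rw [abs_mul, abs_two, abs_of_nonneg (sq_nonneg ‖v‖)]
      nlinarith [norm_nonneg v]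
    calc (t' - t) ^ 2 ≤ (3 * ρ * ‖v‖) ^ 2 := sq_le_sq' (abs_le.1 this).1 (abs_le.1 this).2
      _ = _ := by ring
  -- 182 = 20 · 9 + 2: the quadratic Taylor term together with the ‖v‖² contained in t' - t.
  have h5 : 1 / t' ^ 2 ≤ 1 / t ^ 2 + 4 * i / t ^ 3 + 182 * ρ ^ 2 * ‖v‖ ^ 2 / t ^ 4 := by
    have h6 : 20 * (t' - t) ^ 2 / t ^ 4 ≤ 180 * ρ ^ 2 * ‖v‖ ^ 2 / t ^ 4 := by
      gcongr ?_ / _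
      linarith
    have h7 : -(2 * (t' - t) / t ^ 3) ≤ 4 * i / t ^ 3 + 2 * ρ ^ 2 * ‖v‖ ^ 2 / t ^ 4 := by
      have : 2 * t * ‖v‖ ^ 2 / t ^ 4 ≤ 2 * ρ ^ 2 * ‖v‖ ^ 2 / t ^ 4 := by gcongr
      have e : -(2 * (t' - t) / t ^ 3) = 4 * i / t ^ 3 + 2 * t * ‖v‖ ^ 2 / t ^ 4 := by
        rw [hdiff]; field_simp; ring
      linarith
    have h8 : 182 * ρ ^ 2 * ‖v‖ ^ 2 / t ^ 4 =
        180 * ρ ^ 2 * ‖v‖ ^ 2 / t ^ 4 + 2 * ρ ^ 2 * ‖v‖ ^ 2 / t ^ 4 := by ring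
    linarith
  rw [real_inner_smul_left, h2]
  calc W (x + v) ≤ A * ρ ^ 2 * (1 / t' ^ 2) := h1
    _ ≤ A * ρ ^ 2 * (1 / t ^ 2 + 4 * i / t ^ 3 + 182 * ρ ^ 2 * ‖v‖ ^ 2 / t ^ 4) := by gcongr
    _ = _ := by ring

/-- The terms produced by a large barrier are small compared to `g ^ (q + 2)`. -/
theorem barrier_terms_le {c κ q A X g P K W : ℝ} (hc : 0 < c) (hκ : 0 < κ) (hq : 2 < q)
    (hA1 : 128 * c ^ 3 ≤ A * κ ^ 2) (hA2 : 728 * c ^ 2 ≤ A * κ) (hA3 : 2 * c ≤ A * κ)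
    (hA : 0 < A) (hg : 1 ≤ g) (hP : 0 ≤ P) (hW : W = A * X ^ 2) (hPX : P ≤ 4 * A * X ^ 3)
    (hK : K ≤ 182 * A * X ^ 4) (hW0 : 0 < W) (hgW : W ≤ 2 * (c * g ^ 2))
    (hAg : A ≤ 2 * c * g ^ 2) :
    g ^ (q - 1) * P ≤ κ * (g ^ q * g ^ 2) ∧ K ≤ κ * (g ^ q * g ^ 2) ∧
      1 ≤ κ * (g ^ q * g ^ 2) := by
  have hg0 : 0 < g := by linarith
  have hT2 : g ^ 2 ≤ g ^ q := by
    rw [← Real.rpow_two]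
    exact Real.rpow_le_rpow_of_exponent_le hg hq.le
  have hTone : 1 ≤ g ^ q := (one_le_pow₀ hg).trans hT2
  refine ⟨?_, ?_, ?_⟩
  · have hPκ : P ≤ κ * g ^ 3 := by
      refine le_of_sq_le_sq ?_ (by positivity)
      -- Eliminating X through W = AX² gives P ≲ W^{3/2}/√A, and likewise K ≲ W²/A below: the
      -- negative powers of A are the gain.
      have h3 : A * P ^ 2 ≤ A * (κ * g ^ 3) ^ 2 := by
        calc A * P ^ 2 ≤ A * (4 * A * X ^ 3) ^ 2 := by gcongr
          _ = 16 * W ^ 3 := by rw [hW]; ring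
          _ ≤ 16 * (2 * (c * g ^ 2)) ^ 3 := by gcongr
          _ = 128 * c ^ 3 * g ^ 6 := by ring
          _ ≤ A * κ ^ 2 * g ^ 6 := by gcongr
          _ = _ := by ring
      exact le_of_mul_le_mul_left h3 hA
    have e : g ^ (q - 1) * g = g ^ q := by
      rw [← Real.rpow_add_one hg0.ne', sub_add_cancel]
    calc g ^ (q - 1) * P ≤ g ^ (q - 1) * (κ * g ^ 3) := by gcongr
      _ = κ * ((g ^ (q - 1) * g) * g ^ 2) := by ring
      _ = _ := by rw [e]
  · have h1 : A * K ≤ A * (κ * (g ^ q * g ^ 2)) := by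
      calc A * K ≤ A * (182 * A * X ^ 4) := by gcongr
        _ = 182 * W ^ 2 := by rw [hW]; ring
        _ ≤ 182 * (2 * (c * g ^ 2)) ^ 2 := by gcongr
        _ = 728 * c ^ 2 * (g ^ 2 * g ^ 2) := by ring
        _ ≤ (A * κ) * (g ^ q * g ^ 2) := by gcongr
        _ = _ := by ring
    exact le_of_mul_le_mul_left h1 hA
  · have h1 : 1 ≤ κ * g ^ 2 := by
      have : 2 * c * 1 ≤ 2 * c * (κ * g ^ 2) := by
        calc 2 * c * 1 ≤ A * κ := by linarith
          _ ≤ 2 * c * g ^ 2 * κ := by gcongr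
          _ = _ := by ring
      exact le_of_mul_le_mul_left this (by positivity)
    calc 1 ≤ κ * (1 * g ^ 2) := by linarith
      _ ≤ _ := by gcongr

/-- Here T = g^q and G₂ = g². If E ≥ mT/2, the term EW exceeds the right side; otherwise F is at
most -NmT/4, so Γ is at least of order T² ≥ TG₂. The two bounds on M are the constants of these two
cases. -/
theorem not_bernstein_of_small {b c c₂ m N M ε T E F W G₂ Γ : ℝ} (hb : 0 < b)
    (hc : 0 < c) (hc₂ : 0 ≤ c₂) (hm : 0 < m) (hN : 0 < N) (hM : 0 < M)
    (hM1 : M ≤ N * b * m * c / 8) (hM2 : M ≤ c * N ^ 2 * m ^ 2 / 32)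
    (hε1 : ε ≤ M / 2) (hε2 : ε * c₂ ≤ M / 2) (hT : 0 < T) (hG₂ : 0 < G₂) (hGT : G₂ ≤ T)
    (hNm : 1 ≤ N * (m / 4) * T) (hGW : c * G₂ / 2 ≤ W) (hE : 0 < E) (hΓ : 0 ≤ Γ)
    (hF : |F - N * (E - m * T)| ≤ 1) (hFΓ : F ^ 2 ≤ c₂ * Γ)
    (hmain : N * (b / 2) * E * W + c / 2 * Γ ≤ ε * (T * G₂)) : False := by
  have hTg : 0 < T * G₂ := by positivity
  have hW0 : 0 ≤ W := le_trans (by positivity) hGW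
  have h6 : 0 < M * (T * G₂) := by positivity
  rcases le_or_gt (m / 2 * T) E with hcase | hcase
  · have h1 : N * (b / 2) * (m / 2 * T) * (c * G₂ / 2) ≤ N * (b / 2) * E * W := by
      gcongr
    have h3 := mul_le_mul_of_nonneg_right hM1 hTg.le
    have h4 := mul_le_mul_of_nonneg_right hε1 hTg.le
    have h5 : 0 ≤ c / 2 * Γ := by positivity
    linarith
  · have hF1 : N * (m / 4) * T ≤ -F := by
      have h1 := (abs_le.1 hF).2
      have h2 := mul_le_mul_of_nonneg_left hcase.le hN.le
      linarith
    have hF2 : (N * (m / 4) * T) ^ 2 ≤ F ^ 2 := by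
      rw [← neg_sq F]; gcongr
    have h1 : c / 2 * Γ ≤ ε * (T * G₂) := by
      have : 0 ≤ N * (b / 2) * E * W := by positivity
      linarith
    have h2 : c / 2 * F ^ 2 ≤ c₂ * (ε * (T * G₂)) := by
      calc c / 2 * F ^ 2 ≤ c / 2 * (c₂ * Γ) := by gcongr
        _ = c₂ * (c / 2 * Γ) := by ring
        _ ≤ _ := by gcongr
    have h3 := mul_le_mul_of_nonneg_right hε2 hTg.le
    have h4 : M * (T * G₂) ≤ c * N ^ 2 * m ^ 2 / 32 * (T * T) := by
      gcongr
    have h5 : c / 2 * (N * (m / 4) * T) ^ 2 ≤ c / 2 * F ^ 2 := by gcongr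
    linarith

/-- The Bernstein inequality cannot hold where a large barrier touches. -/
theorem exists_forall_not_bernstein {b c c₂ m q N : ℝ} (hb : 0 < b) (hc : 0 < c) (hc₂ : 0 ≤ c₂)
    (hm : 0 < m) (hq : 2 < q) (hN : 0 < N) :
    ∃ A₀ > 0, ∀ A X g P K W E F Γ : ℝ, A₀ ≤ A → 1 ≤ X → 0 ≤ g → 0 ≤ P → W = A * X ^ 2 →
      P ≤ 4 * A * X ^ 3 → K ≤ 182 * A * X ^ 4 → |W - c * g ^ 2| ≤ 1 → 0 < E → 0 ≤ Γ →
      |F - N * (E - m * g ^ q)| ≤ 1 → F ^ 2 ≤ c₂ * Γ →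
      N * (b / 2) * E * W + c / 2 * Γ ≤ K * c₂ + N * m * q / 2 * (g ^ (q - 1) * P) + 1 →
      False := by
  set D := c₂ + N * m * q / 2 + 1 with hD
  have hD0 : 0 < D := by positivity
  set M := min (N * b * m * c / 8) (c * N ^ 2 * m ^ 2 / 32) with hM
  have hM0 : 0 < M := by positivity
  set κ := M / (2 * (1 + c₂) * D) with hκ
  have hκ0 : 0 < κ := by positivity
  have hκD : κ * D * (1 + c₂) = M / 2 := by
    rw [hκ]; field_simp
  -- One summand per requirement: W ≤ 2cg², the three conditions of `barrier_terms_le`, N(m/4)g^q ≥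
  -- 1, and g ≥ 1.
  refine ⟨2 + 128 * c ^ 3 / κ ^ 2 + 728 * c ^ 2 / κ + 2 * c / κ + 8 * c / (N * m) + 2 * c,
    by positivity, ?_⟩
  intro A X g P K W E F Γ hA hX hg hP hW hPX hK hWg hE hΓ hF hFΓ hmain
  have t1 : 0 < 128 * c ^ 3 / κ ^ 2 := by positivity
  have t2 : 0 < 728 * c ^ 2 / κ := by positivity
  have t3 : 0 < 2 * c / κ := by positivity
  have t4 : 0 < 8 * c / (N * m) := by positivity
  have hA1 : 128 * c ^ 3 / κ ^ 2 ≤ A := by linarith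
  have hA2 : 728 * c ^ 2 / κ ≤ A := by linarith
  have hA3 : 2 * c / κ ≤ A := by linarith
  have hA4 : 8 * c / (N * m) ≤ A := by linarith
  have hA5 : 2 * c ≤ A := by linarith
  have hA6 : 2 ≤ A := by linarith
  clear_value M κ
  rw [div_le_iff₀ (by positivity)] at hA1 hA2 hA3 hA4
  have hA0 : 0 < A := by linarith
  have hAW : A ≤ W := by
    rw [hW]; exact le_mul_of_one_le_right hA0.le (one_le_pow₀ hX)
  obtain ⟨hg1, hg2⟩ := abs_le.1 hWg
  have hgW : W ≤ 2 * (c * g ^ 2) := by linarith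
  have hg2A : A ≤ 2 * c * g ^ 2 := by linarith
  have hg21 : 1 ≤ g ^ 2 := by
    have : 2 * c * 1 ≤ 2 * c * g ^ 2 := by linarith
    exact le_of_mul_le_mul_left this (by positivity)
  have hgone : 1 ≤ g := (one_le_sq_iff₀ hg).1 hg21
  have hT2 : g ^ 2 ≤ g ^ q := by
    rw [← Real.rpow_two]
    exact Real.rpow_le_rpow_of_exponent_le hgone hq.le
  obtain ⟨hPκ, hKκ, h1κ⟩ := barrier_terms_le hc hκ0 hq hA1 hA2 hA3 hA0 hgone hP hW hPX hK
    (hA0.trans_le hAW) hgW hg2A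
  have hκD0 : 0 ≤ κ * D := by positivity
  have hκDc : 0 ≤ κ * D * c₂ := by positivity
  refine not_bernstein_of_small (ε := κ * D) (T := g ^ q) (G₂ := g ^ 2) hb hc hc₂ hm hN hM0
    (hM ▸ min_le_left _ _) (hM ▸ min_le_right _ _) (by linarith) (by linarith)
    (by linarith) (by linarith) hT2 ?_ (by linarith) hE hΓ hF hFΓ (hmain.trans ?_)
  · have h1 : 2 * c * 4 ≤ 2 * c * (g ^ 2 * (N * m)) := by
      calc 2 * c * 4 ≤ A * (N * m) := by linarith
        _ ≤ 2 * c * g ^ 2 * (N * m) := by gcongr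
        _ = _ := by ring
    have h2 := le_of_mul_le_mul_left h1 (by positivity)
    have h3 : g ^ 2 * (N * m) ≤ g ^ q * (N * m) := by gcongr
    linarith
  · have h1 := mul_le_mul_of_nonneg_right hKκ hc₂
    have h2 := mul_le_mul_of_nonneg_left hPκ (by positivity : 0 ≤ N * m * q / 2)
    rw [hD]
    linarith

variable {E : Type*} [NormedAddCommGroup E] [InnerProductSpace ℝ E] [FiniteDimensional ℝ E]
  [MeasurableSpace E] [BorelSpace E] {μ ν : Measure E} [IsFiniteMeasure μ] [IsFiniteMeasure ν]
  {c : ℝ}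

/-- C is fixed before u, B and L, which affect only the choice of r. The barrier touching W is found
by maximizing (ρ² - |z - x₀|²)² W(z) over the closed ball. -/
theorem IsIsotropicPair.exists_norm_sq_gradient_le (h : IsIsotropicPair μ ν c) (hc : 0 < c)
    (hν : 0 < ν.real univ) {a b m q : ℝ} (ha : 0 < a) (hb : 0 < b) (hm : 0 < m) (hq : 2 < q) :
    ∃ C > 0, ∀ (u f : E → ℝ) (G : E → E) (B L : ℝ),
      (∀ x, HasFDerivAt u (innerSL ℝ (G x)) x) → UniformContinuous G → UniformContinuous f →
      (∀ x, f x = a * Real.exp (b * u x) - m * ‖G x‖ ^ q) → (∀ x, |u x| ≤ B) →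
      (∀ x, ‖G x‖ ≤ L) → ∀ (x₀ : E) (ρ : ℝ), 0 < ρ → ρ ≤ 1 →
      HasMeanFlux μ ν (ball x₀ (2 * ρ)) G f → ‖G x₀‖ ^ 2 ≤ C / ρ ^ 2 := by
  obtain ⟨A₀, hA₀, HA⟩ := exists_forall_not_bernstein (c₂ := ∫ y, ‖y‖ ^ 2 ∂μ) hb hc
    (integral_nonneg fun _ => sq_nonneg _) hm hq hν
  refine ⟨(A₀ + 1) / c, by positivity, fun u f G B L hu hG hf hfu hB hL x₀ ρ hρ hρ1 hflux => ?_⟩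
  have huc : Continuous u := continuous_iff_continuousAt.2 fun x => (hu x).continuousAt
  obtain ⟨r₀, hr₀, H₀⟩ := h.bernstein hc ha hb hm hq hu hG hf hfu hB hL hflux
  obtain ⟨η₁, hη₁, H₁⟩ := h.abs_meanSqDiff_sub_le hu hG hL
  obtain ⟨r, hr, hrr⟩ : ∃ r, 0 < r ∧ r < min (min r₀ η₁) (ρ / 2) := exists_between (by positivity)
  simp only [lt_min_iff] at hrr
  obtain ⟨⟨hr0, hr1⟩, hr2⟩ := hrr
  have hrsq : 0 < r ^ 2 := by positivity
  set W : E → ℝ := fun x => meanSqDiff μ u r x / r ^ 2 with hW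
  have hWc : Continuous W := (continuous_meanSqDiff huc hB r).div_const _
  have hWg : ∀ x, |W x - c * ‖G x‖ ^ 2| ≤ 1 := fun x => by
    have e : W x - c * ‖G x‖ ^ 2 =
        (meanSqDiff μ u r x - r ^ 2 * (c * ‖G x‖ ^ 2)) / r ^ 2 := by
      simp only [hW]; field_simp
    rw [e, abs_div, abs_of_pos hrsq, div_le_one hrsq]
    exact H₁ r hr hr1 x
  have hmain : W x₀ ≤ A₀ / ρ ^ 2 := by
    by_contra! hlt
    rw [div_lt_iff₀ (by positivity)] at hlt
    obtain ⟨x, hx, hmax⟩ := (isCompact_closedBall x₀ ρ).exists_isMaxOn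
      (nonempty_closedBall.2 hρ.le) (f := fun z => (ρ ^ 2 - ‖z - x₀‖ ^ 2) ^ 2 * W z)
      (by fun_prop)
    set A := (ρ ^ 2 - ‖x - x₀‖ ^ 2) ^ 2 * W x / ρ ^ 2 with hA
    have hAeq : (ρ ^ 2 - ‖x - x₀‖ ^ 2) ^ 2 * W x = A * ρ ^ 2 := by rw [hA]; field_simp
    have hle : ∀ z ∈ closedBall x₀ ρ, (ρ ^ 2 - ‖z - x₀‖ ^ 2) ^ 2 * W z ≤ A * ρ ^ 2 :=
      fun z hz => (hmax hz).trans hAeq.le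
    have hA0 : A₀ ≤ A := by
      have h1 := hle x₀ (mem_closedBall_self hρ.le)
      simp only [sub_self, norm_zero] at h1
      have h2 : ρ ^ 2 * (W x₀ * ρ ^ 2) ≤ ρ ^ 2 * A := by linarith
      have h3 := le_of_mul_le_mul_left h2 (by positivity)
      linarith
    have hApos : 0 < A := hA₀.trans_le hA0
    have hxn : ‖x - x₀‖ ≤ ρ := by rwa [mem_closedBall, dist_eq_norm] at hx
    have hxlt : ‖x - x₀‖ < ρ := by
      refine lt_of_le_of_ne hxn fun e => ?_
      rw [e, sub_self] at hAeq
      have : 0 < A * ρ ^ 2 := by positivity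
      simp at hAeq
      rcases hAeq with h' | h' <;> linarith
    have hxball : x ∈ ball x₀ ρ := by rwa [mem_ball, dist_eq_norm]
    have hpar := eventually_le_paraboloid hρ hApos.le hxball hle hAeq
    set t := ρ ^ 2 - ‖x - x₀‖ ^ 2 with ht
    have ht0 : 0 < t := by rw [ht]; nlinarith [norm_nonneg (x - x₀)]
    have htρ : t ≤ ρ := by rw [ht]; nlinarith [sq_nonneg ‖x - x₀‖]
    obtain ⟨Γ, F, hΓ, hF, hFΓ, hineq⟩ := H₀ r hr hr0 (ρ / 2) (by positivity) x _ _
      (fun y hy => by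
        rw [mem_closedBall] at hy
        rw [mem_ball] at hxball ⊢
        linarith [dist_triangle y x x₀]) (by
        filter_upwards [hpar] with v hv
        have h1 := mul_le_mul_of_nonneg_left hv hrsq.le
        simp only [hW, mul_add, mul_div_cancel₀ _ hrsq.ne'] at h1 ⊢
        exact h1)
    clear_value A t
    rw [hfu] at hF
    -- X = ρ/t is at least 1 because t ≤ ρ² ≤ ρ; this is where ρ ≤ 1 is needed.
    refine HA A (ρ / t) ‖G x‖ _ _ (W x) (a * Real.exp (b * u x)) F Γ hA0 ?_ (norm_nonneg _)
      (norm_nonneg _) ?_ ?_ ?_ (hWg x) (by positivity) hΓ hF hFΓ hineq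
    · rwa [one_le_div ht0]
    · rw [div_pow, mul_div_assoc', eq_div_iff (by positivity), mul_comm]
      exact hAeq
    · rw [norm_smul, Real.norm_of_nonneg (by positivity)]
      calc 4 * A * ρ ^ 2 / t ^ 3 * ‖x - x₀‖ ≤ 4 * A * ρ ^ 2 / t ^ 3 * ρ := by gcongr
        _ = _ := by ring
    · exact le_of_eq (by ring)
  have h1 := (abs_le.1 (hWg x₀)).1
  have h2 : 1 ≤ 1 / ρ ^ 2 := by
    rw [one_le_div (by positivity)]; nlinarith
  have h3 : c * ‖G x₀‖ ^ 2 ≤ (A₀ + 1) / ρ ^ 2 := by rw [add_div]; linarith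
  rw [div_div, mul_comm c, ← div_div, le_div_iff₀ hc]
  linarith

end Barrier

/-! ### Radial kernels on the plane and the weak equation -/

section Kernel

open Metric Set Filter Topology
open scoped RealInnerProductSpace

/-- A radial smooth bump on the plane. -/
noncomputable def radialBump (y : Plane) : ℝ := Real.smoothTransition (1 - ‖y‖ ^ 2)

/-- The weight `w` for which `∇ radialBump y = - w y • y`. -/
noncomputable def radialWeight (y : Plane) : ℝ := 2 * deriv Real.smoothTransition (1 - ‖y‖ ^ 2)

theorem contDiff_radialBump : ContDiff ℝ ∞ radialBump :=
  Real.smoothTransition.contDiff.comp (contDiff_const.sub (contDiff_norm_sq ℝ))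

theorem hasFDerivAt_radialBump (y : Plane) :
    HasFDerivAt radialBump (-radialWeight y • innerSL ℝ y) y := by
  have h1 : HasDerivAt Real.smoothTransition (deriv Real.smoothTransition (1 - ‖y‖ ^ 2))
      (1 - ‖y‖ ^ 2) :=
    ((Real.smoothTransition.contDiff (n := 1)).differentiable one_ne_zero _).hasDerivAt
  have h2 := h1.comp_hasFDerivAt y ((hasStrictFDerivAt_norm_sq y).hasFDerivAt.const_sub 1)
  convert! h2 using 1
  ext v
  simp [radialWeight]
  ring

theorem continuous_radialWeight : Continuous radialWeight := by
  have := (Real.smoothTransition.contDiff (n := 1)).continuous_deriv le_rfl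
  unfold radialWeight
  fun_prop

theorem radialWeight_nonneg (y : Plane) : 0 ≤ radialWeight y :=
  mul_nonneg two_pos.le Real.smoothTransition.monotone.deriv_nonneg

theorem radialBump_nonneg (y : Plane) : 0 ≤ radialBump y := Real.smoothTransition.nonneg _

theorem radialBump_eq_zero {y : Plane} (hy : 1 < ‖y‖) : radialBump y = 0 :=
  Real.smoothTransition.zero_of_nonpos (by nlinarith)

theorem radialWeight_eq_zero {y : Plane} (hy : 1 < ‖y‖) : radialWeight y = 0 := by
  have : Real.smoothTransition =ᶠ[𝓝 (1 - ‖y‖ ^ 2)] fun _ => 0 := by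
    filter_upwards [gt_mem_nhds (show 1 - ‖y‖ ^ 2 < 0 by nlinarith)] with t ht
    exact Real.smoothTransition.zero_of_nonpos ht.le
  rw [radialWeight, this.deriv_eq]
  simp

theorem hasCompactSupport_of_eq_zero {w : Plane → ℝ} (hw : ∀ y, 1 < ‖y‖ → w y = 0) :
    HasCompactSupport w :=
  HasCompactSupport.intro (isCompact_closedBall (0 : Plane) 1) fun y hy => hw y (by simpa using hy)

theorem exists_radialWeight_pos : ∃ y : Plane, y ≠ 0 ∧ 0 < radialWeight y := by
  obtain ⟨t, ht, h⟩ := exists_deriv_eq_slope Real.smoothTransition zero_lt_one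
    Real.smoothTransition.continuous.continuousOn
    ((Real.smoothTransition.contDiff (n := 1)).differentiable one_ne_zero).differentiableOn
  have h1 : 0 < 1 - t := by linarith [ht.2]
  have hn : ‖(EuclideanSpace.single (0 : Fin 2) (√(1 - t)) : Plane)‖ ^ 2 = 1 - t := by
    simp [Real.sq_sqrt h1.le]
  refine ⟨EuclideanSpace.single (0 : Fin 2) (√(1 - t)), fun h0 => ?_, ?_⟩
  · rw [h0] at hn
    simp at hn
    linarith
  · rw [radialWeight, hn, sub_sub_cancel, h]
    simp

theorem isFiniteMeasure_withDensity_of_eq_zero {w : Plane → ℝ} (hwc : Continuous w)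
    (hw : ∀ y, 1 < ‖y‖ → w y = 0) :
    IsFiniteMeasure ((volume : Measure Plane).withDensity fun y => ENNReal.ofReal (w y)) :=
  isFiniteMeasure_withDensity_ofReal
    (hwc.integrable_of_hasCompactSupport (hasCompactSupport_of_eq_zero hw)).2

theorem ae_norm_le_withDensity {w : Plane → ℝ} (hwc : Continuous w)
    (hw : ∀ y, 1 < ‖y‖ → w y = 0) :
    ∀ᵐ y ∂((volume : Measure Plane).withDensity fun y => ENNReal.ofReal (w y)), ‖y‖ ≤ 1 := by
  rw [ae_withDensity_iff (by fun_prop)]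
  refine Eventually.of_forall fun y hy => ?_
  by_contra! h
  exact hy (by rw [hw y h, ENNReal.ofReal_zero])

theorem integral_withDensity_ofReal {w : Plane → ℝ} (hwc : Continuous w) (hw : ∀ y, 0 ≤ w y)
    (F : Plane → ℝ) :
    ∫ y, F y ∂((volume : Measure Plane).withDensity fun y => ENNReal.ofReal (w y)) =
      ∫ y, w y * F y := by
  rw [integral_withDensity_eq_integral_toReal_smul (by fun_prop)
    (Eventually.of_forall fun _ => ENNReal.ofReal_lt_top)]
  simp [ENNReal.toReal_ofReal (hw _)]

/-- The measure with density `radialWeight`. -/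
noncomputable def weightMeasure : Measure Plane :=
  volume.withDensity fun y => ENNReal.ofReal (radialWeight y)

/-- The measure with density `radialBump`. -/
noncomputable def bumpMeasure : Measure Plane :=
  volume.withDensity fun y => ENNReal.ofReal (radialBump y)

instance : IsFiniteMeasure weightMeasure :=
  isFiniteMeasure_withDensity_of_eq_zero continuous_radialWeight fun _ => radialWeight_eq_zero

instance : IsFiniteMeasure bumpMeasure :=
  isFiniteMeasure_withDensity_of_eq_zero contDiff_radialBump.continuous
    fun _ => radialBump_eq_zero

theorem integral_weightMeasure (F : Plane → ℝ) :
    ∫ y, F y ∂weightMeasure = ∫ y, radialWeight y * F y :=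
  integral_withDensity_ofReal continuous_radialWeight radialWeight_nonneg F

theorem integral_bumpMeasure (F : Plane → ℝ) :
    ∫ y, F y ∂bumpMeasure = ∫ y, radialBump y * F y :=
  integral_withDensity_ofReal contDiff_radialBump.continuous radialBump_nonneg F

/-- The quarter turn J preserves the weight, and ⟪v, y⟫² + ⟪v, Jy⟫² = ‖v‖²‖y‖², so each summand
contributes half. -/
theorem integral_radialWeight_inner_sq (v : Plane) :
    ∫ y, radialWeight y * ⟪v, y⟫ ^ 2 = (∫ y, radialWeight y * ‖y‖ ^ 2) / 2 * ‖v‖ ^ 2 := by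
  have : Fact (Module.finrank ℝ Plane = 2) := ⟨by simp⟩
  let o : Orientation ℝ Plane (Fin 2) := (EuclideanSpace.basisFun (Fin 2) ℝ).toBasis.orientation
  have hint : ∀ F : Plane → ℝ, Continuous F → Integrable fun y => radialWeight y * F y :=
    fun F hF => (continuous_radialWeight.mul hF).integrable_of_hasCompactSupport
      (hasCompactSupport_of_eq_zero fun y hy => by simp [radialWeight_eq_zero hy])
  have hrot : ∫ y, radialWeight y * ⟪v, o.rightAngleRotation y⟫ ^ 2 =
      ∫ y, radialWeight y * ⟪v, y⟫ ^ 2 := by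
    rw [← (o.rightAngleRotation.measurePreserving).integral_comp
      o.rightAngleRotation.toHomeomorph.measurableEmbedding]
    simp [radialWeight]
  have hsum : (∫ y, radialWeight y * ⟪v, y⟫ ^ 2) +
      ∫ y, radialWeight y * ⟪v, o.rightAngleRotation y⟫ ^ 2 =
        (∫ y, radialWeight y * ‖y‖ ^ 2) * ‖v‖ ^ 2 := by
    rw [← integral_add (hint (fun y => ⟪v, y⟫ ^ 2) (by fun_prop))
      (hint (fun y => ⟪v, o.rightAngleRotation y⟫ ^ 2) (by fun_prop)), ← integral_mul_const]
    refine integral_congr_ae (Eventually.of_forall fun y => ?_)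
    have := o.inner_sq_add_areaForm_sq v y
    simp only [o.inner_rightAngleRotation_right, neg_sq]
    rw [← mul_add, this]
    ring
  rw [hrot] at hsum
  linarith

theorem integral_radialWeight_norm_sq_pos : 0 < ∫ y, radialWeight y * ‖y‖ ^ 2 := by
  obtain ⟨y, hy0, hy⟩ := exists_radialWeight_pos
  refine (continuous_radialWeight.mul (by fun_prop)).integral_pos_of_hasCompactSupport_nonneg_nonzero
    (x := y) (hasCompactSupport_of_eq_zero fun y hy => by simp [radialWeight_eq_zero hy])
    (fun y => mul_nonneg (radialWeight_nonneg y) (sq_nonneg _)) ?_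
  have := norm_pos_iff.2 hy0
  positivity

theorem isIsotropicPair_weightMeasure : IsIsotropicPair weightMeasure bumpMeasure
    ((∫ y, radialWeight y * ‖y‖ ^ 2) / 2) where
  norm_le_left := ae_norm_le_withDensity continuous_radialWeight fun _ => radialWeight_eq_zero
  norm_le_right := ae_norm_le_withDensity contDiff_radialBump.continuous
    fun _ => radialBump_eq_zero
  first_moment v := by
    rw [integral_weightMeasure]
    have := integral_neg_eq_self (fun y => radialWeight y * ⟪v, y⟫) (volume : Measure Plane)
    simp only [radialWeight, norm_neg, inner_neg_right, mul_neg, integral_neg] at this ⊢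
    linarith
  second_moment v := by rw [integral_weightMeasure, integral_radialWeight_inner_sq]

theorem bumpMeasure_real_univ_pos : 0 < bumpMeasure.real univ := by
  have h1 : bumpMeasure.real univ = ∫ y, radialBump y := by
    have := integral_bumpMeasure fun _ => 1
    simpa using this
  rw [h1]
  exact contDiff_radialBump.continuous.integral_pos_of_hasCompactSupport_nonneg_nonzero (x := 0)
    (hasCompactSupport_of_eq_zero fun _ => radialBump_eq_zero) radialBump_nonneg
    (by simp [radialBump])

theorem integral_mul_laplacian {u ζ : Plane → ℝ} {G Z : Plane → Plane}
    (hu : ∀ x, HasFDerivAt u (innerSL ℝ (G x)) x) (hG : Continuous G) (hζ : ContDiff ℝ ∞ ζ)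
    (hζc : HasCompactSupport ζ) (hZ : ∀ x, HasFDerivAt ζ (innerSL ℝ (Z x)) x) :
    Integrable (fun x => u x * Δ ζ x) ∧ ∫ x, u x * Δ ζ x = -∫ x, ⟪G x, Z x⟫ := by
  have huc : Continuous u := continuous_iff_continuousAt.2 fun x => (hu x).continuousAt
  set v := EuclideanSpace.basisFun (Fin 2) ℝ
  have hζ1 : ContDiff ℝ 1 (fderiv ℝ ζ) := hζ.fderiv_right (by norm_cast)
  have hg : ∀ i, ContDiff ℝ 1 fun x => fderiv ℝ ζ x (v i) := fun i => hζ1.clm_apply contDiff_const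
  have hgc : ∀ i, HasCompactSupport fun x => fderiv ℝ ζ x (v i) := fun i => hζc.fderiv_apply ℝ _
  have hgg : ∀ i x, fderiv ℝ (fun x => fderiv ℝ ζ x (v i)) x (v i) =
      fderiv ℝ (fderiv ℝ ζ) x (v i) (v i) := fun i x => by
    have h1 := ((hζ1.differentiable one_ne_zero x).hasFDerivAt).clm_apply
      (hasFDerivAt_const (v i) x)
    rw [h1.fderiv]
    simp
  have hlap : ∀ x, u x * Δ ζ x = ∑ i, u x * fderiv ℝ (fun x => fderiv ℝ ζ x (v i)) x (v i) := by
    intro x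
    rw [InnerProductSpace.laplacian_eq_iteratedFDeriv_orthonormalBasis ζ v, Finset.mul_sum]
    simp [iteratedFDeriv_two_apply, hgg]
  have hint1 : ∀ i, Integrable fun x => u x * fderiv ℝ (fun x => fderiv ℝ ζ x (v i)) x (v i) :=
    fun i => (huc.mul (((hg i).continuous_fderiv one_ne_zero).clm_apply
      continuous_const)).integrable_of_hasCompactSupport ((hgc i).fderiv_apply ℝ _).mul_left
  have hfu : ∀ x, fderiv ℝ u x = innerSL ℝ (G x) := fun x => (hu x).fderiv
  have hint2 : ∀ i, Integrable fun x => fderiv ℝ u x (v i) * fderiv ℝ ζ x (v i) := fun i => by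
    refine Continuous.integrable_of_hasCompactSupport ?_ (hgc i).mul_left
    refine Continuous.mul ?_ (hg i).continuous
    simp only [hfu, innerSL_apply_apply]
    fun_prop
  have hibp : ∀ i, ∫ x, u x * fderiv ℝ (fun x => fderiv ℝ ζ x (v i)) x (v i) =
      -∫ x, fderiv ℝ u x (v i) * fderiv ℝ ζ x (v i) := fun i =>
    integral_mul_fderiv_eq_neg_fderiv_mul_of_integrable (hint2 i) (hint1 i)
      ((huc.mul (hg i).continuous).integrable_of_hasCompactSupport (hgc i).mul_left)
      (fun x _ => (hu x).differentiableAt) fun x _ => (hg i).differentiable one_ne_zero x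
  simp_rw [hlap]
  refine ⟨integrable_finsetSum _ fun i _ => hint1 i, ?_⟩
  rw [integral_finsetSum _ fun i _ => hint1 i]
  simp_rw [hibp]
  rw [Finset.sum_neg_distrib, ← integral_finsetSum _ fun i _ => hint2 i]
  congr 1
  refine integral_congr_ae (Eventually.of_forall fun x => ?_)
  simp only [hfu, (hZ x).fderiv, innerSL_apply_apply]
  rw [← v.sum_inner_mul_inner]
  simp only [real_inner_comm]

/-- Test with the bump rescaled to the ball of radius s about x; its gradient is radial with profile
`radialWeight`, so one integration by parts and a change of variables give the flux. -/
theorem hasMeanFlux_of_weak {u f : Plane → ℝ} {G : Plane → Plane} {U : Set Plane}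
    (hu : ∀ x, HasFDerivAt u (innerSL ℝ (G x)) x) (hG : Continuous G) (hf : Continuous f)
    (hweak : ∀ ζ : Plane → ℝ, ContDiff ℝ ∞ ζ → HasCompactSupport ζ → tsupport ζ ⊆ U →
      ∫ x, (-(u x * Δ ζ x) + f x * ζ x) = 0) :
    HasMeanFlux weightMeasure bumpMeasure U G f := by
  intro x s hs hxU
  set ζ : Plane → ℝ := fun z => radialBump (s⁻¹ • (z - x)) with hζdef
  have hζ : ContDiff ℝ ∞ ζ := contDiff_radialBump.comp (by fun_prop)
  have hζ0 : ∀ z ∉ closedBall x s, ζ z = 0 := fun z hz => by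
    refine radialBump_eq_zero ?_
    rw [mem_closedBall, dist_eq_norm, not_le] at hz
    rw [norm_smul, norm_inv, Real.norm_of_nonneg hs.le, inv_mul_eq_div, one_lt_div hs]
    exact hz
  have hts : tsupport ζ ⊆ closedBall x s := closure_minimal
    (fun z hz => by by_contra h; exact hz (hζ0 z h)) isClosed_closedBall
  have hζc : HasCompactSupport ζ := HasCompactSupport.intro (isCompact_closedBall x s) hζ0
  set Z : Plane → Plane := fun z => (-radialWeight (s⁻¹ • (z - x)) * s⁻¹ ^ 2) • (z - x) with hZdef
  have hZ : ∀ z, HasFDerivAt ζ (innerSL ℝ (Z z)) z := fun z => by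
    have h1 : HasFDerivAt (fun z : Plane => s⁻¹ • (z - x))
        (s⁻¹ • ContinuousLinearMap.id ℝ Plane) z :=
      ((hasFDerivAt_id z).sub_const x).const_smul s⁻¹
    have h2 := (hasFDerivAt_radialBump (s⁻¹ • (z - x))).comp z h1
    convert! h2 using 1
    ext w
    simp only [hZdef, innerSL_apply_apply, ContinuousLinearMap.comp_apply,
      _root_.smul_apply, ContinuousLinearMap.id_apply, real_inner_smul_left,
      real_inner_smul_right, smul_eq_mul]
    ring
  obtain ⟨hint, hlap⟩ := integral_mul_laplacian hu hG hζ hζc hZ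
  have h0 := hweak ζ hζ hζc (hts.trans hxU)
  have hfi : Integrable fun z => f z * ζ z :=
    (hf.mul hζ.continuous).integrable_of_hasCompactSupport hζc.mul_left
  rw [integral_add (f := fun z => -(u z * Δ ζ z)) hint.neg hfi, integral_neg, hlap, neg_neg] at h0
  have hsub : ∀ F : Plane → ℝ, ∫ z, F z = |s ^ 2| * ∫ y, F (x + s • y) := fun F => by
    rw [← integral_add_left_eq_self F x,
      Measure.integral_comp_smul volume (fun y => F (x + y)) s]
    have : (s ^ 2 : ℝ) ≠ 0 := by positivity
    simp [abs_inv]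
    field_simp
  rw [hsub fun z => ⟪G z, Z z⟫, hsub fun z => f z * ζ z, ← mul_add] at h0
  have hs2 : |s ^ 2| ≠ 0 := by positivity
  have h1 := (mul_eq_zero.1 h0).resolve_left hs2
  rw [integral_weightMeasure, integral_bumpMeasure]
  have e1 : ∫ y, ⟪G (x + s • y), Z (x + s • y)⟫ =
      -s⁻¹ * ∫ y, radialWeight y * ⟪y, G (x + s • y)⟫ := by
    rw [← integral_const_mul]
    refine integral_congr_ae (Eventually.of_forall fun y => ?_)
    simp only [hZdef, add_sub_cancel_left, smul_smul, inv_mul_cancel₀ hs.ne', one_smul,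
      real_inner_smul_right, real_inner_comm]
    field_simp
  have e2 : ∫ y, f (x + s • y) * ζ (x + s • y) = ∫ y, radialBump y * f (x + s • y) := by
    refine integral_congr_ae (Eventually.of_forall fun y => ?_)
    simp only [hζdef, add_sub_cancel_left, smul_smul, inv_mul_cancel₀ hs.ne', one_smul, mul_comm]
  rw [e1, e2] at h1
  field_simp at h1
  linarith

end Kernel

/-! ### Localization and the interior gradient estimate -/

section GradientEstimate

open Metric Set Filter Topology
open scoped RealInnerProductSpace

theorem isOpen_puncturedDisk : IsOpen puncturedDisk :=
  isOpen_ball.sdiff isClosed_singleton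

theorem laplacian_eq_zero_of_notMem_tsupport {ζ : Plane → ℝ} {x : Plane} (hx : x ∉ tsupport ζ) :
    Δ ζ x = 0 := by
  have h := InnerProductSpace.laplacian_congr_nhds (notMem_tsupport_iff_eventuallyEq.1 hx)
  rw [h.eq_of_nhds]
  exact congrFun (InnerProductSpace.laplacian_const (c := (0 : ℝ))) x

/-- A `C¹` function on an open set agrees on a smaller ball with a compactly supported one. -/
theorem exists_contDiff_eq_on_ball {u : Plane → ℝ} {Ω : Set Plane} (hΩ : IsOpen Ω)
    (hu : ContDiffOn ℝ 1 u Ω) {x : Plane} {R : ℝ} (hR : 0 < R) (hball : ball x R ⊆ Ω) :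
    ∃ w : Plane → ℝ, ContDiff ℝ 1 w ∧ HasCompactSupport w ∧ ∀ z ∈ ball x (R / 2), w z = u z := by
  let χ : ContDiffBump x := ⟨R / 2, 3 * R / 4, by positivity, by linarith⟩
  have hχs : tsupport χ ⊆ Ω := by
    rw [χ.tsupport_eq]
    refine Subset.trans (closedBall_subset_ball ?_) hball
    simp only [χ]
    linarith
  refine ⟨fun z => χ z * u z, contDiff_iff_contDiffAt.2 fun z => ?_,
    χ.hasCompactSupport.mul_right, fun z hz => ?_⟩
  · by_cases hz : z ∈ Ω
    · exact χ.contDiffAt.mul (hu.contDiffAt (hΩ.mem_nhds hz))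
    · have h0 := notMem_tsupport_iff_eventuallyEq.1 fun h => hz (hχs h)
      refine (contDiffAt_const (c := (0 : ℝ))).congr_of_eventuallyEq ?_
      filter_upwards [h0] with y hy
      simp [hy]
  · simp only [χ.one_of_mem_closedBall (ball_subset_closedBall hz), one_mul]

/-- The interior gradient estimate, by the Bernstein method applied to difference quotients. -/
theorem exists_norm_gradient_le {a b m q : ℝ} (ha : 0 < a) (hb : 0 < b) (hm : 0 < m)
    (hq : 2 < q) :
    ∃ C > 0, ∀ (u : Plane → ℝ) (Ω : Set Plane), IsOpen Ω → IsSolutionOn a b m q Ω u →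
      ∀ (x : Plane) (R : ℝ), 0 < R → R ≤ 1 → ball x R ⊆ Ω → ‖∇ u x‖ ≤ C / R := by
  obtain ⟨C, hC, H⟩ := isIsotropicPair_weightMeasure.exists_norm_sq_gradient_le
    (half_pos integral_radialWeight_norm_sq_pos) bumpMeasure_real_univ_pos ha hb hm hq
  -- The truncated function agrees with u only on the ball of radius R/2 = 2ρ, so ρ = R/4, whence
  -- the factor 4.
  refine ⟨4 * √C, by positivity, fun u Ω hΩ hsol x R hR hR1 hball => ?_⟩
  obtain ⟨w, hw, hwc, hwu⟩ := exists_contDiff_eq_on_ball hΩ hsol.contDiffOn hR hball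
  have hgrad : ∀ z ∈ ball x (R / 2), ∇ w z = ∇ u z := fun z hz =>
    Filter.EventuallyEq.gradient_eq (by
      filter_upwards [isOpen_ball.mem_nhds hz] with y hy using hwu y hy)
  have hwG : ∀ z, HasFDerivAt w (innerSL ℝ (∇ w z)) z := fun z => by
    have h := (hw.differentiable one_ne_zero z).hasGradientAt.hasFDerivAt
    convert! h using 1
  have hG0 : ∀ z ∉ tsupport w, ∇ w z = 0 := fun z hz => by
    rw [(notMem_tsupport_iff_eventuallyEq.1 hz).gradient_eq]
    exact gradient_const z 0
  have hGc : Continuous (∇ w) :=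
    (InnerProductSpace.toDual ℝ Plane).symm.continuous.comp (hw.continuous_fderiv one_ne_zero)
  have hGs : HasCompactSupport (∇ w) := HasCompactSupport.intro hwc hG0
  obtain ⟨L, hL⟩ := hGs.exists_bound_of_continuous hGc
  obtain ⟨B, hB⟩ := hwc.exists_bound_of_continuous hw.continuous
  set f : Plane → ℝ := fun z => a * Real.exp (b * w z) - m * ‖∇ w z‖ ^ q with hf
  have hfc : Continuous f := by
    have : Continuous fun z => ‖∇ w z‖ ^ q :=
      hGc.norm.rpow_const fun _ => Or.inr (by linarith)
    have := hw.continuous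
    fun_prop
  have hfu : UniformContinuous f := by
    -- Off the support of w both w and ∇w vanish, so f equals a there.
    have hfs : HasCompactSupport fun z => f z - a := HasCompactSupport.intro hwc fun z hz => by
      simp only [hf, hG0 z hz, image_eq_zero_of_notMem_tsupport hz, norm_zero,
        Real.zero_rpow (show q ≠ 0 by linarith)]
      simp
    have := (hfs.uniformContinuous_of_continuous (by fun_prop)).add
      (uniformContinuous_const (b := a))
    simpa using this
  have hflux : HasMeanFlux weightMeasure bumpMeasure (ball x (2 * (R / 4))) (∇ w) f := by
    refine hasMeanFlux_of_weak hwG hGc hfc fun ζ hζ hζc hζs => ?_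
    have e : 2 * (R / 4) = R / 2 := by ring
    rw [e] at hζs
    have hsub : tsupport ζ ⊆ Ω := hζs.trans ((ball_subset_ball (by linarith)).trans hball)
    rw [← hsol.weak_eq ζ hζ hζc hsub, setIntegral_eq_integral_of_forall_compl_eq_zero]
    · refine integral_congr_ae (Eventually.of_forall fun z => ?_)
      by_cases hz : z ∈ tsupport ζ
      · simp only [hf, hwu z (hζs hz), hgrad z (hζs hz)]
      · simp [laplacian_eq_zero_of_notMem_tsupport hz, image_eq_zero_of_notMem_tsupport hz]
    · intro z hz
      have hz' : z ∉ tsupport ζ := fun h => hz (hsub h)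
      simp [laplacian_eq_zero_of_notMem_tsupport hz', image_eq_zero_of_notMem_tsupport hz']
  have hx := H w f (∇ w) B L hwG (hGs.uniformContinuous_of_continuous hGc) hfu (fun _ => rfl)
    hB hL x (R / 4) (by positivity) (by linarith) hflux
  rw [hgrad x (mem_ball_self (by positivity))] at hx
  refine le_of_sq_le_sq (hx.trans (le_of_eq ?_)) (by positivity)
  rw [div_pow, div_pow, mul_pow, Real.sq_sqrt hC.le]
  field_simp

end GradientEstimate

/-! ### The estimate in the punctured disk -/

theorem proposition4p6 (a b m q δ : ℝ) (ha : 0 < a) (hb : 0 < b) (hm : 0 < m) (hq : 2 < q)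
    (hδ : 0 < δ) :
    ∃ C : ℝ, 0 < C ∧
      ∀ u : Plane → ℝ, IsSolutionOn a b m q puncturedDisk u →
        (∀ x ∈ puncturedDisk, 0 < u x) →
        ∀ x ∈ Metric.ball (0 : Plane) (1 - δ) \ {0}, ‖∇ u x‖ ≤ C / ‖x‖ := by
  obtain ⟨C, hC, H⟩ := exists_norm_gradient_le ha hb hm hq
  refine ⟨C / min 1 δ, by positivity, fun u hu _ x hx => ?_⟩
  have hx1 : ‖x‖ < 1 - δ := by simpa using hx.1
  have hx0 : 0 < ‖x‖ := norm_pos_iff.2 hx.2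
  have hR : 0 < min ‖x‖ (1 - ‖x‖) := lt_min hx0 (by linarith)
  have hball : Metric.ball x (min ‖x‖ (1 - ‖x‖)) ⊆ puncturedDisk := fun y hy => by
    rw [Metric.mem_ball, lt_min_iff] at hy
    refine ⟨?_, fun h0 => ?_⟩
    · rw [Metric.mem_ball, dist_zero_right]
      have := dist_triangle y x 0
      rw [dist_zero_right, dist_zero_right] at this
      linarith
    · rw [Set.mem_singleton_iff.1 h0, dist_zero_left] at hy
      exact lt_irrefl _ hy.1
  refine (H u _ isOpen_puncturedDisk hu x _ hR
    ((min_le_left _ _).trans (by linarith)) hball).trans ?_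
  rw [div_div]
  -- The distance to the outer circle is comparable to ‖x‖ because δ‖x‖ ≤ δ < 1 - ‖x‖.
  have h1 : min 1 δ * ‖x‖ ≤ min ‖x‖ (1 - ‖x‖) := by
    refine le_min ?_ ?_
    · exact mul_le_of_le_one_left hx0.le (min_le_left _ _)
    · calc min 1 δ * ‖x‖ ≤ δ * 1 := by
            gcongr
            · exact min_le_right _ _
            · linarith
        _ ≤ _ := by linarith
  gcongr
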